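/- For graphs $H,F$ let $ex(n,H,F)$ denote the maximum number of copies of $H$ (that is, not necessarily induced subgraphs isomorphic to $H$) in a simple graph on $n$ vertices that contains no copy of $F$. Let $C_m$ be the cycle on $m$ vertices and $(a)_l=a(a-1)\cdots(a-l+1)$. All asymptotics are for $n\to\infty$ with $k,l$ fixed integers. (1) For all $l\ge 3$ and $k\ge 2$, $$ex(n,C_{2l},C_{2k})\le (1+o(1))\,\frac{2^{l-2}(k-1)^l}{2l}\,n^l.$$ (2) For all $k>l\ge 2$, $$ex(n,C_{2l},C_{2k})\ge (1+o(1))\,\frac{(k-1)_l}{2l}\,n^l.$$ (3) For all $l>k\ge 3$, $$ex(n,C_{2l},C_{2k})\ge (1+o(1))\,\frac{1}{l^l}\,n^l.$$ (4) For all $k,l\ge 2$ with $k\ne l$, $ex(n,C_{2l},C_{2k})=\Theta(n^l)$. -/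

import Mathlib

open Filter Topology Asymptotics

open scoped Classical in
/-- The generalized Turán number `ex(n, H, F)`: the maximum number of (unlabelled, not necessarily
induced) copies of `H` in an `F`-free simple graph on `n` vertices. It is used only for graphs `F`
with an edge, for which the empty graph is `F`-free, so that the maximum is over a nonempty finite
set. -/
noncomputable def genTuran (n : ℕ) {W X : Type*} (H : SimpleGraph W) (F : SimpleGraph X) : ℕ :=
  (Finset.univ.filter fun G : SimpleGraph (Fin n) => F.Free G).sup fun G => G.copyCount H

/-- `ex(n, C_{2l}, C_{2k})` as a real number. -/
noncomputable def exEvenCycle (l k n : ℕ) : ℝ :=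
  (genTuran n (SimpleGraph.cycleGraph (2 * l)) (SimpleGraph.cycleGraph (2 * k)) : ℝ)

/-- `f(n) ≤ (1 + o(1)) g(n)`. -/
def AsympLE (f g : ℕ → ℝ) : Prop :=
  ∃ ε : ℕ → ℝ, Tendsto ε atTop (𝓝 0) ∧ ∀ n, f n ≤ (1 + ε n) * g n

/-- `f(n) ≥ (1 + o(1)) g(n)`. -/
def AsympGE (f g : ℕ → ℝ) : Prop :=
  ∃ ε : ℕ → ℝ, Tendsto ε atTop (𝓝 0) ∧ ∀ n, (1 + ε n) * g n ≤ f n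

/-!
# Even cycles in graphs without a given even cycle

Write `n` for the number of vertices and `codeg (u, v)` for the number of common neighbours of `u`
and `v`.

**Upper bound.** A labelled copy of `C_{2l}` is a closed walk of length `2l`, so there are at most
`tr (A ^ 2) ^ l ≤ ‖A ^ 2‖ ^ l` of them, where `A` is the adjacency matrix and the norm is the
Frobenius norm (`labelledCopyCount_cycleGraph_sq_le`). The entries of `A ^ 2` are the codegrees.
Hence everything follows from a bound on the sum of the squared codegrees in a `C_{2k}`-free graph.
It is at most about `2 (k - 1)² n²`; the version with `5/2` in place of `2`
(`exists_sum_codeg_sq_le`) suffices, because `(5/2) ^ l ≤ 4 ^ (l - 1)` for `l ≥ 3`. Each unlabelled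
cycle is counted `4l` times (`labelledCopyCount_cycleGraph`).

For that sum, fix a large constant `K` and call a pair of distinct vertices fat if its codegree
exceeds `K`, thin otherwise. For fixed `v`, a greedily built path that starts and ends in the
neighbourhood of `v` would close to a `2k`-cycle; therefore all but `O(deg v)` of the vertices in
thin pairs with `v` have codegree at most `k - 1` with `v` (`sum_thinPairs_le`), and the degrees sum
to `O(n ^ (3/2))` (`sum_degree_sq_le`). Fat pairs are compared with thin pairs by counting
`4`-cycles, each of which has two diagonals: few `4`-cycles have two fat diagonals, since a path in
the graph of fat pairs can be subdivided by common neighbours to a path in the graph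
(`sum_fatPairs_le`).

**Lower bounds.** For `l < k`, the graph `K_{k-1, n-k+1}` has no `2k`-cycle
(`two_mul_descFactorial_le_genTuran`). For `l > k ≥ 3`, blow up every other vertex of `C_{2l}`
(`pow_le_genTuran_blowup`): the only cycles have length `4` or `2l`. For `k = 2`, take the
point-line incidence graph of an affine plane, where points in general position determine a cycle
(`pow_le_genTuran_incidence`).
-/

/-! ### Labelled and unlabelled copies -/

namespace SimpleGraph

variable {V W : Type*}

theorem labelledCopyCount_eq_natCard [Fintype V] [Fintype W] (G : SimpleGraph V)
    (H : SimpleGraph W) : G.labelledCopyCount H = Nat.card (Copy H G) := by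
  rw [labelledCopyCount]
  exact Fintype.card_eq_nat_card

/-- Precomposing one labelled copy of `H` with the automorphisms of `H` yields exactly the labelled
copies with the same underlying subgraph. -/
theorem labelledCopyCount_eq_copyCount_mul_card_aut [Fintype V] [Fintype W] (G : SimpleGraph V)
    (H : SimpleGraph W) :
    G.labelledCopyCount H = G.copyCount H * Nat.card (H ≃g H) := by
  classical
  let _ : Fintype (H ≃g H) := Fintype.ofInjective (fun σ => (σ : W → W)) DFunLike.coe_injective
  have key : ∀ f : Copy H G, ∀ S : G.Subgraph, f.toSubgraph = S →
      ∃ e : H ≃g S.coe, ∀ x, (e x : V) = f x := by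
    rintro f S rfl
    exact ⟨f.isoToSubgraph, fun x => rfl⟩
  rw [labelledCopyCount, copyCount_eq_card_image_copyToSubgraph, ← Finset.card_univ,
    Finset.card_eq_sum_card_image (Copy.toSubgraph (A := H) (B := G)), Finset.sum_const_nat]
  intro S hS
  obtain ⟨f₀, -, hf₀⟩ := Finset.mem_image.1 hS
  obtain ⟨e₀, he₀⟩ := key f₀ S hf₀
  rw [Nat.card_eq_fintype_card, ← Finset.card_univ]
  symm
  refine Finset.card_bij (fun σ _ => f₀.comp σ.toCopy) ?_ ?_ ?_
  · intro σ _
    simp only [Finset.mem_filter, Finset.mem_univ, true_and]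
    rw [← hf₀]
    ext a b
    · constructor
      · rintro ⟨x, -, rfl⟩
        exact ⟨σ x, trivial, rfl⟩
      · rintro ⟨x, -, rfl⟩
        exact ⟨σ.symm x, trivial, congrArg f₀ (σ.apply_symm_apply x)⟩
    · simp only [Subgraph.map_adj, Subgraph.top_adj, Relation.map_apply]
      constructor
      · rintro ⟨x, y, h, rfl, rfl⟩
        exact ⟨σ x, σ y, σ.map_adj_iff.2 h, rfl, rfl⟩
      · rintro ⟨x, y, h, rfl, rfl⟩
        exact ⟨σ.symm x, σ.symm y, σ.symm.map_adj_iff.2 h, by simp, by simp⟩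
  · intro σ _ τ _ h
    ext x
    exact f₀.injective (DFunLike.congr_fun h x)
  · intro f hf
    simp only [Finset.mem_filter, Finset.mem_univ, true_and] at hf
    obtain ⟨e, he⟩ := key f S hf
    refine ⟨e.trans e₀.symm, Finset.mem_univ _, ?_⟩
    ext x
    simp only [Copy.comp_apply]
    change f₀ (e₀.symm (e x)) = f x
    rw [← he₀, ← he]
    simp

/-- A family of copies whose underlying vertex sets are distinct yields distinct subgraphs. -/
theorem card_le_copyCount {ι : Type*} [Fintype ι] [Fintype V] [Finite W] {G : SimpleGraph V}
    {H : SimpleGraph W} (f : ι → Copy H G)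
    (hf : Function.Injective fun t => Set.range (f t)) :
    Fintype.card ι ≤ G.copyCount H := by
  classical
  cases nonempty_fintype W
  rw [copyCount_eq_card_image_copyToSubgraph, ← Finset.card_univ]
  refine Finset.card_le_card_of_injOn (fun t => (f t).toSubgraph)
    (fun t _ => Finset.mem_coe.2 (Finset.mem_image_of_mem _ (Finset.mem_univ _))) ?_
  intro s _ t _ hst
  apply hf
  have := congrArg Subgraph.verts hst
  simpa using this

/-- A copy of a cycle in `G` from a cyclic sequence of distinct vertices. -/
def cycleCopy {G : SimpleGraph V} (N : ℕ) (g : ℕ → V)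
    (hadj : ∀ i, i + 1 < N → G.Adj (g i) (g (i + 1))) (hlast : G.Adj (g (N - 1)) (g 0))
    (hinj : Set.InjOn g (Set.Iio N)) :
    Copy (cycleGraph N) G where
  toHom :=
    { toFun := fun i => g i
      map_rel' := by
        intro a b hab
        wlog hle : a.val ≤ b.val generalizing a b
        · exact (this hab.symm (by lia)).symm
        have hne : a.val ≠ b.val := fun h => hab.ne (Fin.ext h)
        rcases cycleGraph_adj'.1 hab with h | h
        · rw [Fin.coe_sub_iff_lt.mpr (by rw [Fin.lt_def]; lia)] at h
          have ha : a.val = 0 := by lia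
          have hb : b.val = N - 1 := by lia
          rw [ha, hb]
          exact hlast.symm
        · rw [Fin.coe_sub_iff_le.mpr (by rw [Fin.le_def]; lia)] at h
          have hb : b.val = a.val + 1 := by lia
          rw [hb]
          exact hadj _ (by lia) }
  injective' := fun a b h => Fin.ext (hinj a.2 b.2 h)

theorem cycleGraph_adj_succ {m : ℕ} (x : Fin (m + 2)) : (cycleGraph (m + 2)).Adj x (x + 1) := by
  rw [cycleGraph_adj]; right; simp

/-- An injective endomorphism of a cycle preserves arithmetic progressions of difference `1`: the
two neighbours of a vertex go to the two neighbours of its image. -/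
theorem Copy.cycleGraph_add_eq {m : ℕ} (σ : Copy (cycleGraph (m + 3)) (cycleGraph (m + 3)))
    (i : Fin (m + 3)) : σ (i + 1 + 1) + σ i = σ (i + 1) + σ (i + 1) := by
  have h1 := σ.toHom.map_adj (cycleGraph_adj_succ (m := m + 1) i)
  have h2 := σ.toHom.map_adj (cycleGraph_adj_succ (m := m + 1) (i + 1))
  have h3 : σ (i + 1 + 1) ≠ σ i := by
    intro h
    have h : i + 1 + 1 = i := σ.injective h
    rw [add_assoc, add_eq_left] at h
    exact ne_of_beq_false rfl h
  simp only [Copy.toHom_apply] at h1 h2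
  rw [cycleGraph_adj] at h1 h2
  rcases h1 with h1 | h1 <;> rcases h2 with h2 | h2
  · rw [← sub_eq_zero] at h1 h2 ⊢
    have : σ (i + 1 + 1) + σ i - (σ (i + 1) + σ (i + 1))
      = (σ i - σ (i + 1) - 1) - (σ (i + 1) - σ (i + 1 + 1) - 1) := by abel
    rw [this, h1, h2]; simp
  · exact absurd (by rw [sub_eq_iff_eq_add] at h1 h2; rw [h1, h2]) h3
  · refine absurd ?_ h3
    have : σ (i + 1) - σ (i + 1 + 1) = σ (i + 1) - σ i := by rw [h1, h2]
    simpa using this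
  · rw [← sub_eq_zero] at h1 h2 ⊢
    have : σ (i + 1 + 1) + σ i - (σ (i + 1) + σ (i + 1))
      = (σ (i + 1 + 1) - σ (i + 1) - 1) - (σ (i + 1) - σ i - 1) := by abel
    rw [this, h1, h2]; simp

/-- An automorphism of a cycle is determined by the image of one dart, and every dart is attained by
a rotation or a reflection. -/
theorem card_aut_cycleGraph {N : ℕ} (hN : 3 ≤ N) :
    Nat.card (cycleGraph N ≃g cycleGraph N) = 2 * N := by
  obtain ⟨m, rfl⟩ := Nat.exists_eq_add_of_le' hN
  have hcard : Fintype.card (cycleGraph (m + 3)).Dart = 2 * (m + 3) := by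
    rw [dart_card_eq_sum_degrees, Finset.sum_congr rfl fun v _ => cycleGraph_degree_three_le]
    simp [mul_comm]
  rw [← hcard, ← Nat.card_eq_fintype_card]
  refine Nat.card_congr (Equiv.ofBijective
    (fun σ => ⟨(σ 0, σ 1), σ.map_adj_iff.2 (by rw [cycleGraph_adj]; right; simp)⟩) ⟨?_, ?_⟩)
  · intro σ τ h
    have h0 : σ 0 = τ 0 := congrArg (fun d => d.fst) h
    have h1 : σ 1 = τ 1 := congrArg (fun d => d.snd) h
    have key : ∀ j : ℕ, σ (Fin.ofNat (m + 3) j) = τ (Fin.ofNat (m + 3) j) ∧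
        σ (Fin.ofNat (m + 3) j + 1) = τ (Fin.ofNat (m + 3) j + 1) := by
      intro j
      induction j with
      | zero => exact ⟨h0, by simpa using h1⟩
      | succ j ih =>
        have hs : Fin.ofNat (m + 3) (j + 1) = Fin.ofNat (m + 3) j + 1 := by
          ext; simp [Fin.val_add]
        rw [hs]
        refine ⟨ih.2, ?_⟩
        have a := σ.toCopy.cycleGraph_add_eq (Fin.ofNat (m + 3) j)
        have b := τ.toCopy.cycleGraph_add_eq (Fin.ofNat (m + 3) j)
        change σ _ + σ _ = σ _ + σ _ at a
        change τ _ + τ _ = τ _ + τ _ at b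
        rw [ih.1, ih.2, ← b] at a
        exact add_right_cancel a
    ext i
    have := (key i).1
    simpa using congrArg Fin.val this
  · rintro ⟨⟨x, y⟩, hxy⟩
    have hxy' : x - y = 1 ∨ y - x = 1 := hxy
    rcases hxy' with h | h
    · refine ⟨⟨Equiv.subLeft x, ?_⟩, ?_⟩
      · intro a b
        simp [cycleGraph_adj, or_comm]
      · ext1
        simp only [RelIso.coe_fn_mk, Equiv.subLeft_apply, sub_zero, ← h, sub_sub_cancel]
    · refine ⟨⟨Equiv.addLeft x, ?_⟩, ?_⟩
      · intro a b
        simp [cycleGraph_adj]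
      · ext1
        simp only [RelIso.coe_fn_mk, Equiv.coe_addLeft, add_zero, ← h, add_sub_cancel]

theorem labelledCopyCount_cycleGraph [Fintype V] (G : SimpleGraph V) {N : ℕ} (hN : 3 ≤ N) :
    G.labelledCopyCount (cycleGraph N) = G.copyCount (cycleGraph N) * (2 * N) := by
  rw [labelledCopyCount_eq_copyCount_mul_card_aut, card_aut_cycleGraph hN]

end SimpleGraph

/-! ### Greedy paths and dense cores -/

namespace SimpleGraph

variable {V : Type*} {G : SimpleGraph V}

section Greedy

variable [DecidableEq V]

/-- If from every vertex of `A` two further steps, first into `U` and then into `A`, are possible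
while avoiding any set `T` of the size of a path on fewer than `2k` vertices, then there are paths of
length `2i` for all `i < k`, with at most `i + 1` vertices outside `U`. The bound on `T \ U` lets the
vertices of `U` have as few as `k` neighbours in `A` when `A` and `U` are disjoint. -/
theorem exists_isPath_of_two_step {A U : Finset V} {v : V} {k : ℕ} (hA : ∀ a ∈ A, G.Adj v a)
    (hU : v ∉ U)
    (hstep : ∀ a ∈ A, ∀ T : Finset V, T.card < 2 * k → (T \ U).card < k →
      ∃ y ∈ U, y ∉ T ∧ ∃ a' ∈ A, a' ∉ T ∧ G.Adj a y ∧ G.Adj y a')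
    {a₀ : V} (ha₀ : a₀ ∈ A) (i : ℕ) (hi : i < k) :
    ∃ b ∈ A, ∃ p : G.Walk b a₀, p.IsPath ∧ p.length = 2 * i ∧ v ∉ p.support ∧
      (p.support.toFinset \ U).card ≤ i + 1 := by
  induction i with
  | zero =>
    refine ⟨a₀, ha₀, .nil, by simp, by simp, by simpa using (hA a₀ ha₀).ne, ?_⟩
    exact (Finset.card_le_card Finset.sdiff_subset).trans (by simp)
  | succ i ih =>
    obtain ⟨b, hb, p, hp, hlen, hv, hout⟩ := ih (by lia)
    have hT : p.support.toFinset.card < 2 * k := by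
      have := List.toFinset_card_le p.support
      rw [Walk.length_support] at this
      lia
    obtain ⟨y, hy, hyT, a', ha', haT, hby, hya⟩ := hstep b hb _ hT (by lia)
    rw [List.mem_toFinset] at hyT haT
    refine ⟨a', ha', .cons hya.symm (.cons hby.symm p), ?_, by simp [hlen]; lia, ?_, ?_⟩
    · simp [hp, hyT, haT, hya.ne']
    · have h1 : v ≠ a' := (hA a' ha').ne
      have h2 : v ≠ y := fun h => hU (h ▸ hy)
      simp [hv, h1, h2]
    · have : (Walk.cons hya.symm (.cons hby.symm p)).support.toFinset \ U
          ⊆ insert a' (p.support.toFinset \ U) := by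
        intro x
        simp only [Walk.support_cons, List.toFinset_cons, Finset.mem_sdiff, Finset.mem_insert]
        rintro ⟨rfl | rfl | h, hx⟩
        · exact Or.inl rfl
        · exact absurd hy hx
        · exact Or.inr ⟨h, hx⟩
      exact (Finset.card_le_card this).trans ((Finset.card_insert_le _ _).trans (by lia))

/-- The path of `exists_isPath_of_two_step` starts and ends in the neighbourhood of `v`, so `v`
closes it to a cycle of length `2k`. -/
theorem cycleGraph_isContained_of_two_step {A U : Finset V} {v : V} {k : ℕ} (hk : 2 ≤ k)
    (hA : ∀ a ∈ A, G.Adj v a) (hU : v ∉ U) (hne : A.Nonempty)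
    (hstep : ∀ a ∈ A, ∀ T : Finset V, T.card < 2 * k → (T \ U).card < k →
      ∃ y ∈ U, y ∉ T ∧ ∃ a' ∈ A, a' ∉ T ∧ G.Adj a y ∧ G.Adj y a') :
    cycleGraph (2 * k) ⊑ G := by
  obtain ⟨a₀, ha₀⟩ := hne
  obtain ⟨b, hb, p, hp, hlen, hv, -⟩ := exists_isPath_of_two_step hA hU hstep ha₀ (k - 1) (by lia)
  rw [cycleGraph_isContained_iff (by lia)]
  refine ⟨a₀, .cons (hA a₀ ha₀).symm (.cons (hA b hb) p), ?_, by simp [hlen]; lia⟩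
  rw [Walk.cons_isCycle_iff]
  refine ⟨by simp [hp, hv], ?_⟩
  rw [Walk.edges_cons, List.mem_cons, not_or]
  constructor
  · intro h
    have hab : a₀ = b := by
      rcases Sym2.eq_iff.1 h with ⟨-, h⟩ | ⟨h, -⟩
      · exact absurd h (hA b hb).ne
      · exact h
    subst hab
    have := Walk.length_eq_zero_iff.2 (Walk.isPath_iff_nil.1 hp)
    lia
  · intro h
    exact hv (Walk.snd_mem_support_of_mem_edges p h)

end Greedy

/-- A bipartite relation with more than `D (|A| + |U|)` related pairs has a nonempty core all of
whose elements have more than `D` partners inside the core: elements with at most `D` partners can be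
discarded one at a time. -/
theorem exists_core_of_lt_sum {α : Type*} [DecidableEq α] (r : α → α → Prop)
    [∀ a b, Decidable (r a b)] (D : ℕ) (A U : Finset α)
    (h : D * (A.card + U.card) < ∑ a ∈ A, (U.filter (r a)).card) :
    ∃ A' ⊆ A, ∃ U' ⊆ U, A'.Nonempty ∧ (∀ a ∈ A', D < (U'.filter (r a)).card) ∧
      ∀ u ∈ U', D < (A'.filter (fun a => r a u)).card := by
  induction hN : A.card + U.card using Nat.strong_induction_on generalizing A U with
  | _ N ih =>
  subst hN
  by_cases hA : ∃ a ∈ A, (U.filter (r a)).card ≤ D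
  · obtain ⟨a, ha, hd⟩ := hA
    have hc := Finset.card_erase_add_one ha
    have hs := Finset.add_sum_erase A (fun a => (U.filter (r a)).card) ha
    obtain ⟨A', hA', U', hU', hh⟩ := ih ((A.erase a).card + U.card) (by lia) (A.erase a) U
      (by rw [← hc] at h; simp only [← hs] at h; nlinarith) rfl
    exact ⟨A', hA'.trans (Finset.erase_subset _ _), U', hU', hh⟩
  by_cases hU : ∃ u ∈ U, (A.filter (fun a => r a u)).card ≤ D
  · obtain ⟨u, hu, hd⟩ := hU
    have hc := Finset.card_erase_add_one hu
    have hsum : ∀ B : Finset α, ∑ a ∈ A, (B.filter (r a)).card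
        = ∑ b ∈ B, (A.filter (fun a => r a b)).card :=
      fun B => Finset.sum_card_bipartiteAbove_eq_sum_card_bipartiteBelow r
    have hs := Finset.add_sum_erase U (fun u => (A.filter (fun a => r a u)).card) hu
    obtain ⟨A', hA', U', hU', hh⟩ := ih (A.card + (U.erase u).card) (by lia) A (U.erase u)
      (by rw [hsum] at h ⊢; rw [← hc] at h; simp only [← hs] at h; nlinarith) rfl
    exact ⟨A', hA', U', hU'.trans (Finset.erase_subset _ _), hh⟩
  push Not at hA hU
  refine ⟨A, subset_rfl, U, subset_rfl, ?_, hA, hU⟩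
  rw [Finset.nonempty_iff_ne_empty]
  rintro rfl
  simp at h

/-- One-sided version of `exists_core_of_lt_sum`: discarding an element of `A` with few partners
together with all these partners leaves the degrees of the remaining elements of `U` intact. -/
theorem exists_one_sided_core {α : Type*} [DecidableEq α] (r : α → α → Prop)
    [∀ a b, Decidable (r a b)] (D : ℕ) (A U : Finset α) (h : D * A.card < U.card) :
    ∃ A' ⊆ A, ∃ U' ⊆ U, U'.Nonempty ∧ (∀ a ∈ A', D < (U'.filter (r a)).card) ∧
      ∀ u ∈ U', ∀ a ∈ A, r a u → a ∈ A' := by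
  induction hN : A.card generalizing A U with
  | zero =>
    refine ⟨A, subset_rfl, U, subset_rfl, Finset.card_pos.1 (by lia), ?_, fun _ _ a ha _ => ha⟩
    rw [Finset.card_eq_zero.1 hN]
    simp
  | succ N ih =>
    by_cases hA : ∃ a ∈ A, (U.filter (r a)).card ≤ D
    · obtain ⟨a, ha, hd⟩ := hA
      have hc := Finset.card_erase_add_one ha
      have hU := Finset.card_filter_add_card_filter_not (s := U) (r a)
      obtain ⟨A', hA', U', hU', hne, h1, h2⟩ := ih (A.erase a) (U.filter fun u => ¬ r a u)
        (by rw [← hc] at h; nlinarith) (by lia)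
      refine ⟨A', hA'.trans (Finset.erase_subset _ _), U', hU'.trans (Finset.filter_subset _ _), hne,
        h1, fun u hu b hb hbu => h2 u hu b (Finset.mem_erase.2 ⟨?_, hb⟩) hbu⟩
      rintro rfl
      exact (Finset.mem_filter.1 (hU' hu)).2 hbu
    · push Not at hA
      exact ⟨A, subset_rfl, U, subset_rfl, Finset.card_pos.1 (by lia), hA, fun _ _ a ha _ => ha⟩

end SimpleGraph

/-! ### Codegrees in graphs without a `2k`-cycle -/

namespace SimpleGraph

variable {V : Type*} [Fintype V] [DecidableEq V]

/-- The common neighbours of a pair of vertices, as a finset. On the diagonal this is the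
neighbourhood. -/
def commonNbrs (G : SimpleGraph V) [DecidableRel G.Adj] (p : V × V) : Finset V :=
  G.neighborFinset p.1 ∩ G.neighborFinset p.2

/-- The number of common neighbours of a pair of vertices; the degree on the diagonal. -/
def codeg (G : SimpleGraph V) [DecidableRel G.Adj] (p : V × V) : ℕ := (G.commonNbrs p).card

/-- Ordered pairs of distinct vertices with at most `K` common neighbours. -/
def thinPairs (G : SimpleGraph V) [DecidableRel G.Adj] (K : ℕ) : Finset (V × V) :=
  Finset.univ.filter fun p => p.1 ≠ p.2 ∧ G.codeg p ≤ K

/-- Ordered pairs of distinct vertices with more than `K` common neighbours. -/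
def fatPairs (G : SimpleGraph V) [DecidableRel G.Adj] (K : ℕ) : Finset (V × V) :=
  Finset.univ.filter fun p => p.1 ≠ p.2 ∧ K < G.codeg p

variable (G : SimpleGraph V) [DecidableRel G.Adj] {k : ℕ}

theorem mem_commonNbrs {p : V × V} {x : V} :
    x ∈ G.commonNbrs p ↔ G.Adj p.1 x ∧ G.Adj p.2 x := by
  simp [commonNbrs]

theorem commonNbrs_self (v : V) : G.commonNbrs (v, v) = G.neighborFinset v := by
  simp [commonNbrs]

theorem codeg_self (v : V) : G.codeg (v, v) = G.degree v := by
  rw [codeg, commonNbrs_self, card_neighborFinset_eq_degree]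

theorem sum_codeg_eq_sum_degree_sq : ∑ p : V × V, G.codeg p = ∑ v, G.degree v ^ 2 := by
  have : ∀ p : V × V, G.codeg p = ∑ w, if G.Adj p.1 w ∧ G.Adj p.2 w then 1 else 0 := by
    intro p
    rw [← Finset.card_filter, codeg]
    congr 1
    ext x
    simp [mem_commonNbrs]
  simp_rw [this]
  rw [Finset.sum_comm]
  refine Finset.sum_congr rfl fun w _ => ?_
  rw [← Finset.card_filter, ← card_neighborFinset_eq_degree, sq, ← Finset.card_product]
  congr 1
  ext p
  simp [G.adj_comm]

variable {G}

/-- The neighbours of `v` and the other vertices span few edges: otherwise a dense core contains a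
path of length `2k - 2` between two neighbours of `v`. -/
theorem sum_codeg_erase_le (hk : 2 ≤ k) (hG : (cycleGraph (2 * k)).Free G) (v : V) :
    ∑ u ∈ Finset.univ.erase v, G.codeg (v, u) ≤ 4 * k * Fintype.card V := by
  by_contra! hlt
  have hsum : ∑ a ∈ G.neighborFinset v, ((Finset.univ.erase v).filter (G.Adj a)).card
      = ∑ u ∈ Finset.univ.erase v, G.codeg (v, u) := by
    refine (Finset.sum_card_bipartiteAbove_eq_sum_card_bipartiteBelow G.Adj).trans ?_
    refine Finset.sum_congr rfl fun u _ => ?_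
    rw [codeg]
    congr 1
    ext x
    simp [mem_commonNbrs, Finset.bipartiteBelow, G.adj_comm u]
  have h1 : (G.neighborFinset v).card ≤ Fintype.card V := Finset.card_le_univ _
  have h2 : (Finset.univ.erase v).card ≤ Fintype.card V := Finset.card_le_univ _
  obtain ⟨A, hA, U, hU, hne, hAU, hUA⟩ := exists_core_of_lt_sum G.Adj (2 * k) (G.neighborFinset v)
    (Finset.univ.erase v) (by rw [hsum]; nlinarith)
  refine hG (cycleGraph_isContained_of_two_step (A := A) (U := U) (v := v) hk
    (fun a ha => (G.mem_neighborFinset _ _).1 (hA ha))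
    (fun h => absurd (hU h) (Finset.notMem_erase _ _)) hne ?_)
  intro a ha T hT _
  obtain ⟨y, hy, hyT⟩ := Finset.exists_mem_notMem_of_card_lt_card (hT.trans (hAU a ha))
  rw [Finset.mem_filter] at hy
  obtain ⟨b, hb, hbT⟩ := Finset.exists_mem_notMem_of_card_lt_card (hT.trans (hUA y hy.1))
  rw [Finset.mem_filter] at hb
  exact ⟨y, hy.1, hyT, b, hb.1, hbT, hy.2, hb.2.symm⟩

/-- Graphs without a `2k`-cycle have `O(n ^ (3/2))` edges. -/
theorem sum_degree_sq_le (hk : 2 ≤ k) (hG : (cycleGraph (2 * k)).Free G) :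
    (∑ v, G.degree v) ^ 2 ≤ (4 * k + 1) * Fintype.card V ^ 3 := by
  have h1 : ∑ v, G.degree v ^ 2 ≤ (4 * k + 1) * Fintype.card V ^ 2 := by
    rw [← sum_codeg_eq_sum_degree_sq, Fintype.sum_prod_type]
    calc ∑ v, ∑ u, G.codeg (v, u)
        ≤ ∑ _v : V, (4 * k + 1) * Fintype.card V := by
          refine Finset.sum_le_sum fun v _ => ?_
          rw [← Finset.add_sum_erase _ _ (Finset.mem_univ v), codeg_self]
          have := sum_codeg_erase_le hk hG v
          have := (G.degree_lt_card_verts v).le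
          lia
      _ = (4 * k + 1) * Fintype.card V ^ 2 := by simp; ring
  calc (∑ v, G.degree v) ^ 2 ≤ Fintype.card V * ∑ v, G.degree v ^ 2 := by
        simpa using sq_sum_le_card_mul_sum_sq (s := Finset.univ) (f := fun v => G.degree v)
    _ ≤ Fintype.card V * ((4 * k + 1) * Fintype.card V ^ 2) := by gcongr
    _ = _ := by ring

/-- Outside `v` and its neighbourhood, few vertices have `k` or more common neighbours with `v`. The
threshold `k` is sharp, and it is what produces the factor `k - 1` in the main bound. -/
theorem card_codeg_ge_le (hk : 2 ≤ k) (hG : (cycleGraph (2 * k)).Free G) (v : V) :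
    (Finset.univ.filter fun u => u ≠ v ∧ ¬ G.Adj v u ∧ k ≤ G.codeg (v, u)).card
      ≤ 2 * k * G.degree v := by
  by_contra! hlt
  rw [← card_neighborFinset_eq_degree] at hlt
  obtain ⟨A, hA, U, hU, ⟨u, hu⟩, hAU, hUA⟩ := exists_one_sided_core G.Adj _ _ _ hlt
  have hUA' : ∀ u ∈ U, G.commonNbrs (v, u) ⊆ A := fun u hu x hx => by
    rw [mem_commonNbrs] at hx
    exact hUA u hu x ((G.mem_neighborFinset _ _).2 hx.1) hx.2.symm
  have hU' : ∀ u ∈ U, u ≠ v ∧ ¬ G.Adj v u ∧ k ≤ G.codeg (v, u) := fun u hu => by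
    simpa using hU hu
  have hA' : ∀ a ∈ A, G.Adj v a := fun a ha => (G.mem_neighborFinset _ _).1 (hA ha)
  have hne : A.Nonempty := by
    have : (G.commonNbrs (v, u)).Nonempty := Finset.card_pos.1 (by
      have := (hU' u hu).2.2
      rw [codeg] at this
      lia)
    exact this.mono (hUA' u hu)
  refine hG (cycleGraph_isContained_of_two_step (A := A) (U := U) (v := v) hk hA'
    (fun h => (hU' v h).1 rfl) hne ?_)
  intro a ha T hT hTU
  obtain ⟨y, hy, hyT⟩ := Finset.exists_mem_notMem_of_card_lt_card (hT.trans (hAU a ha))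
  rw [Finset.mem_filter] at hy
  obtain ⟨b, hb, hbT⟩ := Finset.exists_mem_notMem_of_card_lt_card
    (hTU.trans_le (hU' y hy.1).2.2)
  have hbA := hUA' y hy.1 hb
  refine ⟨y, hy.1, hyT, b, hbA, fun h => hbT (Finset.mem_sdiff.2 ⟨h, fun hbU => ?_⟩), hy.2,
    ((G.mem_commonNbrs).1 hb).2⟩
  exact (hU' b hbU).2.1 (hA' b hbA)

/-- Among the common neighbours of two vertices there are few fat pairs: a path of `k` vertices in
the graph of fat pairs, subdivided by common neighbours, would close to a `2k`-cycle. -/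
theorem card_fatPairs_inter_le (hk : 2 ≤ k) (hG : (cycleGraph (2 * k)).Free G) {K : ℕ}
    (hK : 2 * k ≤ K) (p : V × V) :
    ((G.fatPairs K).filter (fun q => q ∈ (G.commonNbrs p).offDiag)).card ≤ 4 * k * G.codeg p := by
  by_contra! hlt
  set X := G.commonNbrs p with hX
  set r : V → V → Prop := fun a b => a ≠ b ∧ K < G.codeg (a, b) with hr
  have hsum : ∑ a ∈ X, (X.filter (r a)).card
      = ((G.fatPairs K).filter (fun q => q ∈ X.offDiag)).card := by
    rw [← Finset.card_sigma]
    refine Finset.card_bij (fun s _ => (s.1, s.2)) ?_ ?_ ?_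
    · simp only [Finset.mem_sigma, Finset.mem_filter, fatPairs, Finset.mem_univ, true_and,
        Finset.mem_offDiag, hr]
      tauto
    · rintro ⟨a, b⟩ _ ⟨c, d⟩ _ h
      simpa using h
    · rintro ⟨a, b⟩ h
      simp only [Finset.mem_filter, fatPairs, Finset.mem_univ, true_and, Finset.mem_offDiag] at h
      exact ⟨⟨a, b⟩, by simp only [Finset.mem_sigma, Finset.mem_filter, hr]; tauto, rfl⟩
  obtain ⟨A, hA, U, hU, hne, hAU, hUA⟩ := exists_core_of_lt_sum r (2 * k) X X
    (by rw [hsum]; refine lt_of_eq_of_lt ?_ hlt; rw [codeg]; ring)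
  have hX' : ∀ a ∈ A ∪ U, G.Adj p.1 a := fun a ha =>
    ((G.mem_commonNbrs).1 (Finset.union_subset hA hU ha)).1
  have hr_symm : ∀ a b, r a b → r b a := fun a b h =>
    ⟨h.1.symm, by rw [codeg, commonNbrs, Finset.inter_comm]; exact h.2⟩
  refine hG (cycleGraph_isContained_of_two_step (A := A ∪ U) (U := Finset.univ.erase p.1)
    (v := p.1) hk hX' (Finset.notMem_erase _ _) (hne.mono Finset.subset_union_left) ?_)
  intro a ha T hT _
  have hnext : ∃ b ∈ A ∪ U, b ∉ T ∧ r a b := by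
    rcases Finset.mem_union.1 ha with h | h
    · obtain ⟨b, hb, hbT⟩ := Finset.exists_mem_notMem_of_card_lt_card (hT.trans (hAU a h))
      rw [Finset.mem_filter] at hb
      exact ⟨b, Finset.mem_union_right _ hb.1, hbT, hb.2⟩
    · obtain ⟨b, hb, hbT⟩ := Finset.exists_mem_notMem_of_card_lt_card (hT.trans (hUA a h))
      rw [Finset.mem_filter] at hb
      exact ⟨b, Finset.mem_union_left _ hb.1, hbT, hr_symm _ _ hb.2⟩
  obtain ⟨b, hb, hbT, hab⟩ := hnext
  have hcard : (insert p.1 T).card < (G.commonNbrs (a, b)).card :=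
    lt_of_le_of_lt ((Finset.card_insert_le _ _).trans (by lia)) hab.2
  obtain ⟨y, hy, hyT⟩ := Finset.exists_mem_notMem_of_card_lt_card hcard
  rw [Finset.mem_insert, not_or] at hyT
  rw [mem_commonNbrs] at hy
  exact ⟨y, by simp [hyT.1], hyT.2, b, hb, hbT, hy.1, hy.2.symm⟩

/-- Sums over thin pairs are essentially governed by pairs with at most `k - 1` common neighbours. -/
theorem sum_thinPairs_le (hk : 2 ≤ k) (hG : (cycleGraph (2 * k)).Free G) (K : ℕ) {φ : ℕ → ℕ}
    (hφ : Monotone φ) :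
    ∑ p ∈ G.thinPairs K, φ (G.codeg p)
      ≤ φ (k - 1) * Fintype.card V ^ 2 + φ K * (2 * k + 1) * ∑ v, G.degree v := by
  have hv : ∀ v, ∑ u, (if v ≠ u ∧ G.codeg (v, u) ≤ K then φ (G.codeg (v, u)) else 0)
      ≤ φ (k - 1) * Fintype.card V + φ K * (2 * k + 1) * G.degree v := by
    intro v
    have hpt : ∀ u, (if v ≠ u ∧ G.codeg (v, u) ≤ K then φ (G.codeg (v, u)) else 0)
        ≤ φ (k - 1) + φ K * ((if G.Adj v u then 1 else 0) +
          (if u ≠ v ∧ ¬ G.Adj v u ∧ k ≤ G.codeg (v, u) then 1 else 0)) := by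
      intro u
      by_cases h : v ≠ u ∧ G.codeg (v, u) ≤ K
      · rw [if_pos h]
        have hK := hφ h.2
        by_cases h1 : G.Adj v u
        · simp only [h1, if_true]
          exact hK.trans ((Nat.le_mul_of_pos_right _ (by lia)).trans (Nat.le_add_left _ _))
        · by_cases h2 : k ≤ G.codeg (v, u)
          · simp only [h1, h2, h.1.symm, ne_eq, not_false_eq_true, and_self, if_true, if_false]
            lia
          · exact (hφ (by lia : G.codeg (v, u) ≤ k - 1)).trans (Nat.le_add_right _ _)
      · rw [if_neg h]; exact Nat.zero_le _
    refine (Finset.sum_le_sum fun u _ => hpt u).trans ?_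
    rw [Finset.sum_add_distrib, ← Finset.mul_sum, Finset.sum_add_distrib, ← Finset.card_filter,
      ← Finset.card_filter, Finset.sum_const, Finset.card_univ, smul_eq_mul]
    have h1 := card_codeg_ge_le hk hG v
    have h2 : (Finset.univ.filter fun u => G.Adj v u).card = G.degree v := by
      rw [← card_neighborFinset_eq_degree]; congr 1; ext; simp
    rw [h2]
    have h3 : φ K * (G.degree v + (Finset.univ.filter fun u =>
        u ≠ v ∧ ¬ G.Adj v u ∧ k ≤ G.codeg (v, u)).card)
        ≤ φ K * (G.degree v + 2 * k * G.degree v) := by gcongr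
    linarith [h3]
  rw [thinPairs, Finset.sum_filter, Fintype.sum_prod_type]
  refine (Finset.sum_le_sum fun v _ => hv v).trans (le_of_eq ?_)
  simp only [Finset.sum_add_distrib, ← Finset.mul_sum, Finset.sum_const, Finset.card_univ,
    smul_eq_mul]
  ring

/-- A `4`-cycle has two diagonals. Counting the `4`-cycles with a fat diagonal through the other one,
which is thin for all but few of them, bounds the fat sum by the thin sum. -/
theorem sum_fatPairs_le (hk : 2 ≤ k) (hG : (cycleGraph (2 * k)).Free G) {K : ℕ}
    (hK : 2 * k ≤ K) :
    ∑ p ∈ G.fatPairs K, (G.codeg p * G.codeg p - G.codeg p)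
      ≤ ∑ p ∈ G.thinPairs K, (G.codeg p * G.codeg p - G.codeg p)
        + 4 * k * ∑ p ∈ G.fatPairs K, G.codeg p := by
  have hoff : ∀ p, G.codeg p * G.codeg p - G.codeg p = (G.commonNbrs p).offDiag.card := fun p => by
    rw [Finset.offDiag_card, codeg]
  simp_rw [hoff]
  have hsplit : ∀ p, (G.commonNbrs p).offDiag.card
      = ((G.thinPairs K).filter fun q => q ∈ (G.commonNbrs p).offDiag).card
        + ((G.fatPairs K).filter fun q => q ∈ (G.commonNbrs p).offDiag).card := by
    intro p
    rw [← Finset.card_union_of_disjoint]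
    · congr 1
      ext q
      simp only [thinPairs, fatPairs, Finset.mem_union, Finset.mem_filter, Finset.mem_univ,
        true_and, Finset.mem_offDiag]
      have := le_or_gt (G.codeg q) K
      tauto
    · rw [Finset.disjoint_left]
      simp only [thinPairs, fatPairs, Finset.mem_filter, Finset.mem_univ, true_and]
      intro q h1 h2
      lia
  have hfat : ∑ p ∈ G.fatPairs K, ((G.fatPairs K).filter
      fun q => q ∈ (G.commonNbrs p).offDiag).card ≤ 4 * k * ∑ p ∈ G.fatPairs K, G.codeg p := by
    rw [Finset.mul_sum]
    exact Finset.sum_le_sum fun p _ => card_fatPairs_inter_le hk hG hK p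
  have hthin : ∑ p ∈ G.fatPairs K, ((G.thinPairs K).filter
      fun q => q ∈ (G.commonNbrs p).offDiag).card
      ≤ ∑ q ∈ G.thinPairs K, (G.commonNbrs q).offDiag.card := by
    have := Finset.sum_card_bipartiteAbove_eq_sum_card_bipartiteBelow (s := G.fatPairs K)
      (t := G.thinPairs K) (fun p q => q ∈ (G.commonNbrs p).offDiag)
    simp only [Finset.bipartiteAbove, Finset.bipartiteBelow] at this
    rw [this]
    refine Finset.sum_le_sum fun q _ => Finset.card_le_card fun p hp => ?_
    simp only [Finset.mem_filter, fatPairs, Finset.mem_univ, true_and, Finset.mem_offDiag,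
      mem_commonNbrs] at hp ⊢
    exact ⟨⟨hp.2.1.1.symm, hp.2.2.1.1.symm⟩, ⟨hp.2.1.2.symm, hp.2.2.1.2.symm⟩, hp.1.1⟩
  calc ∑ p ∈ G.fatPairs K, (G.commonNbrs p).offDiag.card
      = ∑ p ∈ G.fatPairs K, (((G.thinPairs K).filter fun q => q ∈ (G.commonNbrs p).offDiag).card
        + ((G.fatPairs K).filter fun q => q ∈ (G.commonNbrs p).offDiag).card) :=
        Finset.sum_congr rfl fun p _ => hsplit p
    _ ≤ _ := by rw [Finset.sum_add_distrib]; exact add_le_add hthin hfat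

/-- In a large graph without a `2k`-cycle, the sum of the squared codegrees (the number of closed
walks of length four) is at most `5/2 (k - 1)² n²`. Up to error terms, thin pairs contribute at most
`(k - 1)² n²`, the diagonal `(k - 1) n²`, and fat pairs `(k - 1) (k - 2) n²`; together this is
`2 (k - 1)² n²`, so there is room for the error terms. -/
theorem exists_sum_codeg_sq_le (hk : 2 ≤ k) : ∃ n₀ : ℕ, ∀ {V : Type*} [Fintype V] [DecidableEq V]
    (G : SimpleGraph V) [DecidableRel G.Adj], n₀ ≤ Fintype.card V → (cycleGraph (2 * k)).Free G →
      ∑ p : V × V, (G.codeg p : ℝ) ^ 2 ≤ 5 / 2 * ((k : ℝ) - 1) ^ 2 * (Fintype.card V : ℝ) ^ 2 := by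
  -- With this `K`, even `4k + 2` times the sum of the codegrees over fat pairs is at most a tenth of
  -- the sum of their squares.
  set K : ℕ := 10 * (4 * k + 2) with hK
  set C : ℕ := 10 * ((K * K + K) * (2 * k + 1)) + 1 with hC
  refine ⟨9 * C ^ 2 * (4 * k + 1), fun {V} _ _ G _ hn hG => ?_⟩
  set n : ℕ := Fintype.card V with hn_def
  set e : ℕ := ∑ v, G.degree v with he
  have hφ1 : Monotone fun c : ℕ => c * c + c := fun a b h => by dsimp; gcongr
  have hφ2 : Monotone fun c : ℕ => c * c - c := fun a b h => by
    simp only [← Nat.mul_sub_one]; gcongr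
  have hthin1 := sum_thinPairs_le hk hG K hφ1
  have hthin2 := sum_thinPairs_le hk hG K hφ2
  have hfat := sum_fatPairs_le hk hG (K := K) (by lia)
  have hedge := sum_degree_sq_le hk hG
  rw [← he, ← hn_def] at hthin1 hthin2
  rw [← he, ← hn_def] at hedge
  have hlin : K * ∑ p ∈ G.fatPairs K, G.codeg p ≤ ∑ p ∈ G.fatPairs K, G.codeg p * G.codeg p := by
    rw [Finset.mul_sum]
    refine Finset.sum_le_sum fun p hp => ?_
    have : K < G.codeg p := (Finset.mem_filter.1 hp).2.2
    gcongr
  have hsub : ∀ s : Finset (V × V), ∑ p ∈ s, (G.codeg p * G.codeg p - G.codeg p)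
      + ∑ p ∈ s, G.codeg p = ∑ p ∈ s, G.codeg p * G.codeg p := by
    intro s
    rw [← Finset.sum_add_distrib]
    exact Finset.sum_congr rfl fun p _ => Nat.sub_add_cancel (Nat.le_mul_self _)
  have hsubF := hsub (G.fatPairs K)
  -- The whole sum splits into the diagonal, the thin pairs and the fat pairs.
  have hsplit : ∀ φ : ℕ → ℕ, ∑ p : V × V, φ (G.codeg p) = ∑ v, φ (G.degree v)
      + (∑ p ∈ G.thinPairs K, φ (G.codeg p) + ∑ p ∈ G.fatPairs K, φ (G.codeg p)) := by
    intro φ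
    rw [← Finset.sum_union]
    · rw [← Finset.sum_filter_add_sum_filter_not _ (fun p : V × V => p.1 = p.2)]
      congr 1
      · symm
        refine Finset.sum_bij (fun v _ => (v, v)) (by simp) (by simp) ?_ ?_
        · rintro ⟨a, b⟩ h
          simp only [Finset.mem_filter, Finset.mem_univ, true_and] at h
          exact ⟨a, by simp, by simp [h]⟩
        · intro v _
          rw [codeg_self]
      · refine Finset.sum_congr ?_ fun _ _ => rfl
        ext p
        simp only [thinPairs, fatPairs, Finset.mem_union, Finset.mem_filter, Finset.mem_univ,
          true_and]
        have := le_or_gt (G.codeg p) K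
        tauto
    · rw [Finset.disjoint_left]
      simp only [thinPairs, fatPairs, Finset.mem_filter, Finset.mem_univ, true_and]
      intro q h1 h2
      lia
  have hsq := hsplit fun c => c * c
  have hid := hsplit fun c => c
  have hdeg := G.sum_codeg_eq_sum_degree_sq
  simp only [sq] at hdeg
  rw [Finset.sum_add_distrib] at hthin1
  obtain ⟨j, rfl⟩ : ∃ j, k = j + 1 := ⟨k - 1, by lia⟩
  have hj : 1 ≤ j := by lia
  simp only [Nat.add_sub_cancel] at hthin1 hthin2
  have hj2 : j * j - j = j * (j - 1) := by rw [Nat.mul_sub_one]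
  have hKK : K * K - K ≤ K * K + K := (Nat.sub_le _ _).trans (Nat.le_add_right _ _)
  have hthin2' : ∑ p ∈ G.thinPairs K, (G.codeg p * G.codeg p - G.codeg p)
      ≤ (j * (j - 1)) * n ^ 2 + (K * K + K) * (2 * (j + 1) + 1) * e := by
    rw [← hj2]
    exact hthin2.trans (by gcongr)
  have hS : ∑ p : V × V, (G.codeg p : ℝ) ^ 2 = ((∑ p : V × V, G.codeg p * G.codeg p : ℕ) : ℝ) := by
    push_cast
    exact Finset.sum_congr rfl fun p _ => sq _
  rw [hS]
  generalize (∑ p ∈ G.thinPairs K, (G.codeg p * G.codeg p - G.codeg p)) = τ at *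
  generalize (∑ p ∈ G.thinPairs K, (G.codeg p * G.codeg p)) = t2 at *
  generalize (∑ p ∈ G.thinPairs K, G.codeg p) = t1 at *
  generalize (∑ p ∈ G.fatPairs K, (G.codeg p * G.codeg p - G.codeg p)) = f0 at *
  generalize (∑ p ∈ G.fatPairs K, (G.codeg p * G.codeg p)) = f2 at *
  generalize (∑ p ∈ G.fatPairs K, G.codeg p) = f1 at *
  generalize (∑ p : V × V, G.codeg p * G.codeg p) = S at *
  generalize (∑ p : V × V, G.codeg p) = S1 at *
  generalize (∑ v, G.degree v * G.degree v) = d2 at *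
  set E : ℕ := (K * K + K) * (2 * (j + 1) + 1) * e with hE
  -- All error terms together are at most `n² / 3`.
  have herr : 3 * (C * e) ≤ n ^ 2 := by
    by_contra! hlt
    have h1 : (n ^ 2) ^ 2 < (3 * (C * e)) ^ 2 := Nat.pow_lt_pow_left hlt (by lia)
    have h2 : (3 * (C * e)) ^ 2 ≤ n * n ^ 3 := calc
      (3 * (C * e)) ^ 2 = 9 * C ^ 2 * e ^ 2 := by ring
      _ ≤ 9 * C ^ 2 * ((4 * (j + 1) + 1) * n ^ 3) := by gcongr
      _ = 9 * C ^ 2 * (4 * (j + 1) + 1) * n ^ 3 := by ring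
      _ ≤ n * n ^ 3 := by gcongr
    rw [← pow_mul, ← pow_succ'] at *
    lia
  have hCE : C * e = 10 * E + e := by rw [hC, hE]; ring
  have h10 : 10 * ((4 * (j + 1) + 2) * f1) ≤ f2 := by rw [← mul_assoc, ← hK]; exact hlin
  clear_value e E C K n
  -- The diagonal contributes `∑ deg² = ∑ codeg`, the sum over all pairs including the diagonal, so
  -- each off-diagonal codegree `c` counts as `c * c + c`.
  have hmain : 9 * S ≤ (9 * (j * j + j) + 10 * (j * (j - 1))) * n ^ 2 + 3 * (C * e) * 3 := by
    rw [add_mul, mul_assoc 9, mul_assoc 10]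
    rw [add_mul] at h10
    generalize (j * j + j) * n ^ 2 = x at *
    generalize j * (j - 1) * n ^ 2 = y at *
    generalize 4 * (j + 1) * f1 = z at *
    lia
  have hjj : 9 * (j * j + j) + 10 * (j * (j - 1)) ≤ 19 * (j * j) := by
    obtain ⟨i, rfl⟩ : ∃ i, j = i + 1 := ⟨j - 1, by lia⟩
    rw [Nat.add_sub_cancel]
    nlinarith
  have hfin : 9 * S ≤ 19 * (j * j) * n ^ 2 + 3 * n ^ 2 := by
    calc 9 * S ≤ _ := hmain
      _ ≤ 19 * (j * j) * n ^ 2 + n ^ 2 * 3 := by gcongr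
      _ = _ := by ring
  have hfinR : 9 * (S : ℝ) ≤ 19 * (j * j) * n ^ 2 + 3 * n ^ 2 := by exact_mod_cast hfin
  have hj1 : (1 : ℝ) ≤ (j : ℝ) ^ 2 := one_le_pow₀ (by exact_mod_cast hj)
  have hn2 : (0 : ℝ) ≤ (n : ℝ) ^ 2 := by positivity
  push_cast
  rw [add_sub_cancel_right]
  nlinarith [mul_le_mul_of_nonneg_right hj1 hn2]

end SimpleGraph

/-! ### Closed walks and the Frobenius norm -/

/-- Submultiplicativity of the squared Frobenius norm. -/
theorem Matrix.sum_sq_mul_le {n : Type*} [Fintype n] (X Y : Matrix n n ℝ) :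
    ∑ i, ∑ j, (X * Y) i j ^ 2 ≤ (∑ i, ∑ j, X i j ^ 2) * ∑ i, ∑ j, Y i j ^ 2 := by
  calc ∑ i, ∑ j, (X * Y) i j ^ 2
      ≤ ∑ i, ∑ j, (∑ x, X i x ^ 2) * ∑ x, Y x j ^ 2 := by
        refine Finset.sum_le_sum fun i _ => Finset.sum_le_sum fun j _ => ?_
        rw [Matrix.mul_apply]
        exact Finset.sum_mul_sq_le_sq_mul_sq _ _ _
    _ = _ := by
        rw [Finset.sum_comm (f := fun i j => Y i j ^ 2), Finset.sum_mul]
        exact Finset.sum_congr rfl fun i _ => (Finset.mul_sum _ _ _).symm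

theorem Matrix.sum_sq_pow_succ_le {n : Type*} [Fintype n] [DecidableEq n] (X : Matrix n n ℝ)
    (l : ℕ) : ∑ i, ∑ j, (X ^ (l + 1)) i j ^ 2 ≤ (∑ i, ∑ j, X i j ^ 2) ^ (l + 1) := by
  induction l with
  | zero => simp
  | succ l ih =>
    rw [pow_succ, pow_succ _ (l + 1)]
    exact (Matrix.sum_sq_mul_le _ _).trans (by gcongr)

/-- The trace of a power is at most the corresponding power of the Frobenius norm. -/
theorem Matrix.trace_pow_sq_le {n : Type*} [Fintype n] [DecidableEq n] (X : Matrix n n ℝ)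
    {l : ℕ} (hl : 2 ≤ l) : (X ^ l).trace ^ 2 ≤ (∑ i, ∑ j, X i j ^ 2) ^ l := by
  obtain ⟨m, rfl⟩ := Nat.exists_eq_add_of_le' hl
  have h1 : (X ^ (m + 2)).trace = ∑ p : n × n, (X ^ (m + 1)) p.1 p.2 * X p.2 p.1 := by
    rw [pow_succ, Fintype.sum_prod_type]
    simp [Matrix.trace, Matrix.mul_apply]
  rw [h1]
  refine (Finset.sum_mul_sq_le_sq_mul_sq _ _ _).trans ?_
  rw [Fintype.sum_prod_type, Fintype.sum_prod_type_right]
  exact (mul_le_mul_of_nonneg_right (Matrix.sum_sq_pow_succ_le X m) (by positivity)).trans_eq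
    (pow_succ _ _).symm

namespace SimpleGraph

variable {V : Type*} [Fintype V] [DecidableEq V] (G : SimpleGraph V) [DecidableRel G.Adj]

theorem exists_closed_walk_cycleGraph {N : ℕ} (hN : 3 ≤ N) :
    ∃ (v : Fin N) (c : (cycleGraph N).Walk v v), c.length = N ∧ ∀ x, ∃ i, c.getVert i = x := by
  obtain ⟨m, rfl⟩ := Nat.exists_eq_add_of_le' hN
  refine ⟨0, cycleGraph.cycle m, cycleGraph.length_cycle, fun x => ⟨m + 3 - x, ?_⟩⟩
  rw [cycleGraph.getVert_cycle (Nat.sub_le _ _)]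
  ext
  simp [Nat.sub_sub_self x.2.le, Nat.mod_eq_of_lt x.2]

/-- A labelled copy of a cycle traces out a closed walk. -/
theorem labelledCopyCount_cycleGraph_le_trace {N : ℕ} (hN : 3 ≤ N) :
    (G.labelledCopyCount (cycleGraph N) : ℝ) ≤ ((G.adjMatrix ℝ) ^ N).trace := by
  classical
  obtain ⟨v₀, c, hlen, hc⟩ := exists_closed_walk_cycleGraph hN
  have h : ((G.adjMatrix ℝ) ^ N).trace
      = (Nat.card (Σ v : V, {p : G.Walk v v | p.length = N}) : ℝ) := by
    rw [Nat.card_eq_fintype_card, Fintype.card_sigma]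
    push_cast
    exact Finset.sum_congr rfl fun v _ => adjMatrix_pow_apply_eq_card_walk ..
  rw [h, labelledCopyCount_eq_natCard, Nat.cast_le]
  let F : Copy (cycleGraph N) G → Σ v : V, {p : G.Walk v v | p.length = N} :=
    fun f => ⟨f.toHom v₀, c.map f.toHom, by simp [hlen]⟩
  refine Nat.card_le_card_of_injective F ?_
  intro f g hfg
  ext x
  obtain ⟨i, rfl⟩ := hc x
  have := congrArg (fun s : Σ v : V, {p : G.Walk v v | p.length = N} => s.2.1.getVert i) hfg
  simp only [F, Walk.getVert_map] at this
  exact this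

theorem adjMatrix_sq_apply (u v : V) : ((G.adjMatrix ℝ) ^ 2) u v = G.codeg (u, v) := by
  rw [sq, adjMatrix_mul_apply, codeg, commonNbrs, ← Finset.filter_mem_eq_inter]
  simp [adjMatrix_apply, G.adj_comm v]

theorem labelledCopyCount_cycleGraph_sq_le {l : ℕ} (hl : 2 ≤ l) :
    (G.labelledCopyCount (cycleGraph (2 * l)) : ℝ) ^ 2
      ≤ (∑ p : V × V, (G.codeg p : ℝ) ^ 2) ^ l := by
  have h1 := G.labelledCopyCount_cycleGraph_le_trace (N := 2 * l) (by lia)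
  have h2 := Matrix.trace_pow_sq_le ((G.adjMatrix ℝ) ^ 2) hl
  rw [← pow_mul] at h2
  simp only [adjMatrix_sq_apply] at h2
  rw [Fintype.sum_prod_type]
  exact (pow_le_pow_left₀ (by positivity) h1 2).trans h2

end SimpleGraph

/-! ### Lower bounds for `genTuran` from graphs on arbitrary vertex types -/

namespace SimpleGraph

variable {V W X : Type*}

/-- A graph on at most `n` vertices embeds into one on `Fin n` that is still `F`-free, if every vertex
of `F` has a neighbour, so that the isolated vertices added are of no use to `F`. -/
theorem exists_free_copy_fin [Fintype V] {G : SimpleGraph V} {F : SimpleGraph X}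
    (hF : ∀ x, ∃ y, F.Adj x y) (hG : F.Free G) {n : ℕ} (hn : Fintype.card V ≤ n) :
    ∃ G' : SimpleGraph (Fin n), F.Free G' ∧ Nonempty (Copy G G') := by
  obtain ⟨e⟩ : Nonempty (V ↪ Fin n) := Function.Embedding.nonempty_of_card_le (by simpa using hn)
  refine ⟨G.map e, ?_, ⟨(Embedding.map e G).toCopy⟩⟩
  rintro ⟨f⟩
  apply hG
  have hrange : ∀ x, ∃ v, e v = f x := by
    intro x
    obtain ⟨y, hxy⟩ := hF x
    obtain ⟨-, v, w, -, hv, -⟩ := f.toHom.map_adj hxy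
    exact ⟨v, hv⟩
  choose g hg using hrange
  refine ⟨⟨g, ?_⟩, ?_⟩
  · intro a b hab
    obtain ⟨-, v, w, hvw, hv, hw⟩ := f.toHom.map_adj hab
    rw [Copy.toHom_apply, ← hg, e.apply_eq_iff_eq] at hv hw
    exact hv ▸ hw ▸ hvw
  · intro a b hab
    apply f.injective
    change f a = f b
    rw [← hg, ← hg]
    exact congrArg e hab

theorem exists_adj_cycleGraph {N : ℕ} (hN : 2 ≤ N) (x : Fin N) : ∃ y, (cycleGraph N).Adj x y := by
  obtain ⟨m, rfl⟩ := Nat.exists_eq_add_of_le' hN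
  exact ⟨x + 1, cycleGraph_adj_succ x⟩

theorem copyCount_le_genTuran {n : ℕ} {H : SimpleGraph W} {F : SimpleGraph X}
    {G : SimpleGraph (Fin n)} (hG : F.Free G) : G.copyCount H ≤ genTuran n H F := by
  classical
  exact Finset.le_sup (f := fun G : SimpleGraph (Fin n) => G.copyCount H)
    (Finset.mem_filter.2 ⟨Finset.mem_univ _, hG⟩)

/-- A family of copies with distinct vertex sets bounds `genTuran` from below. -/
theorem card_le_genTuran [Fintype V] [Finite W] {ι : Type*} [Fintype ι] {G : SimpleGraph V}
    {H : SimpleGraph W} {F : SimpleGraph X} (hF : ∀ x, ∃ y, F.Adj x y) (hG : F.Free G) {n : ℕ}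
    (hn : Fintype.card V ≤ n) (f : ι → Copy H G)
    (hf : Function.Injective fun t => Set.range (f t)) :
    Fintype.card ι ≤ genTuran n H F := by
  obtain ⟨G', hG', ⟨e⟩⟩ := exists_free_copy_fin hF hG hn
  refine (card_le_copyCount (fun t => e.comp (f t)) ?_).trans (copyCount_le_genTuran hG')
  intro s t hst
  apply hf
  simp only [Copy.coe_comp, Set.range_comp] at hst
  exact e.injective.image_injective hst

/-- A family of distinct labelled copies of a cycle bounds `genTuran` from below. -/
theorem card_le_genTuran_cycleGraph [Fintype V] {ι : Type*} [Fintype ι] {G : SimpleGraph V}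
    {F : SimpleGraph X} (hF : ∀ x, ∃ y, F.Adj x y) (hG : F.Free G) {n N : ℕ} (hN : 3 ≤ N)
    (hn : Fintype.card V ≤ n) (f : ι → Copy (cycleGraph N) G) (hf : Function.Injective f) :
    Fintype.card ι ≤ genTuran n (cycleGraph N) F * (2 * N) := by
  obtain ⟨G', hG', ⟨e⟩⟩ := exists_free_copy_fin hF hG hn
  have h1 : Fintype.card ι ≤ G'.labelledCopyCount (cycleGraph N) := by
    rw [labelledCopyCount_eq_natCard, ← Nat.card_eq_fintype_card]
    have : Finite (Copy (cycleGraph N) G') := Finite.of_injective _ DFunLike.coe_injective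
    refine Nat.card_le_card_of_injective (fun t => e.comp (f t)) fun s t hst => hf ?_
    ext x
    exact e.injective (DFunLike.congr_fun hst x)
  rw [labelledCopyCount_cycleGraph G' hN] at h1
  exact h1.trans (Nat.mul_le_mul_right _ (copyCount_le_genTuran hG'))

/-! ### Cycles alternating between two sequences of vertices -/

/-- The interleaving `a 0, b 0, a 1, b 1, …` of two sequences. -/
def interleave (a b : ℕ → V) (i : ℕ) : V := if i % 2 = 0 then a (i / 2) else b (i / 2)

theorem interleave_two_mul (a b : ℕ → V) (i : ℕ) : interleave a b (2 * i) = a i := by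
  simp [interleave]

theorem interleave_two_mul_add_one (a b : ℕ → V) (i : ℕ) : interleave a b (2 * i + 1) = b i := by
  have h1 : (2 * i + 1) % 2 = 1 := by lia
  have h2 : (2 * i + 1) / 2 = i := by lia
  simp [interleave, h1, h2]

/-- The cycle `a 0, b 0, a 1, b 1, …, a (l - 1), b (l - 1)` as a copy of `C_{2l}`. -/
def alternatingCopy {G : SimpleGraph V} {l : ℕ} (hl : 0 < l) (a b : ℕ → V)
    (hab : ∀ i < l, G.Adj (a i) (b i)) (hba : ∀ i, i + 1 < l → G.Adj (b i) (a (i + 1)))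
    (hlast : G.Adj (b (l - 1)) (a 0)) (ha : Set.InjOn a (Set.Iio l)) (hb : Set.InjOn b (Set.Iio l))
    (hne : ∀ i < l, ∀ j < l, a i ≠ b j) : Copy (cycleGraph (2 * l)) G :=
  cycleCopy (2 * l) (interleave a b)
    (by
      intro i hi
      obtain ⟨j, rfl | rfl⟩ := Nat.even_or_odd' i
      · rw [interleave_two_mul, interleave_two_mul_add_one]
        exact hab j (by lia)
      · rw [interleave_two_mul_add_one, show 2 * j + 1 + 1 = 2 * (j + 1) by ring,
          interleave_two_mul]
        exact hba j (by lia))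
    (by
      rw [show 2 * l - 1 = 2 * (l - 1) + 1 by lia, interleave_two_mul_add_one]
      exact hlast)
    (by
      intro i hi j hj hij
      simp only [Set.mem_Iio] at hi hj
      obtain ⟨x, rfl | rfl⟩ := Nat.even_or_odd' i <;> obtain ⟨y, rfl | rfl⟩ := Nat.even_or_odd' j <;>
        simp only [interleave_two_mul, interleave_two_mul_add_one] at hij
      · rw [ha (by simp; lia) (by simp; lia) hij]
      · exact absurd hij (hne x (by lia) y (by lia))
      · exact absurd hij.symm (hne y (by lia) x (by lia))
      · rw [hb (by simp; lia) (by simp; lia) hij])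

section

variable {G : SimpleGraph V} {l : ℕ} {hl : 0 < l} {a b : ℕ → V} (hab hba hlast ha hb hne)

theorem alternatingCopy_even (i : Fin l) :
    alternatingCopy (G := G) hl a b hab hba hlast ha hb hne ⟨2 * i, by lia⟩ = a i :=
  interleave_two_mul a b i

theorem alternatingCopy_odd (i : Fin l) :
    alternatingCopy (G := G) hl a b hab hba hlast ha hb hne ⟨2 * i + 1, by lia⟩ = b i :=
  interleave_two_mul_add_one a b i

theorem range_alternatingCopy :
    Set.range (alternatingCopy (G := G) hl a b hab hba hlast ha hb hne)
      = a '' Set.Iio l ∪ b '' Set.Iio l := by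
  ext x
  constructor
  · rintro ⟨⟨i, hi⟩, rfl⟩
    obtain ⟨j, rfl | rfl⟩ := Nat.even_or_odd' i
    · exact Or.inl ⟨j, by simp; lia, (interleave_two_mul a b j).symm⟩
    · exact Or.inr ⟨j, by simp; lia, (interleave_two_mul_add_one a b j).symm⟩
  · rintro (⟨j, hj, rfl⟩ | ⟨j, hj, rfl⟩)
    · exact ⟨_, alternatingCopy_even hab hba hlast ha hb hne ⟨j, hj⟩⟩
    · exact ⟨_, alternatingCopy_odd hab hba hlast ha hb hne ⟨j, hj⟩⟩

end

/-- The vertices of a `2k`-cycle split into `k` disjoint edges, so a set of vertices that meets every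
edge contains at least `k` of them. -/
theorem Copy.le_card_cover {G : SimpleGraph V} {k : ℕ} (f : Copy (cycleGraph (2 * k)) G)
    {S : Set V} (hS : ∀ x y, G.Adj x y → x ∈ S ∨ y ∈ S) {ι : Type*} [Fintype ι] (φ : S → ι)
    (hφ : Function.Injective φ) :
    k ≤ Fintype.card ι := by
  have h : ∀ j : Fin k, ∃ i : Fin (2 * k), i.val / 2 = j ∧ f i ∈ S := by
    intro j
    have hadj : (cycleGraph (2 * k)).Adj ⟨2 * j, by lia⟩ ⟨2 * j + 1, by lia⟩ := by
      apply pathGraph_le_cycleGraph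
      rw [pathGraph_adj]
      left; rfl
    rcases hS _ _ (f.toHom.map_adj hadj) with h | h
    · exact ⟨_, by simp, h⟩
    · exact ⟨_, by simp; lia, h⟩
  choose g hg hgS using h
  rw [← Fintype.card_fin k]
  refine Fintype.card_le_of_injective (fun j => φ ⟨f (g j), hgS j⟩) fun i j hij => ?_
  have h1 : f (g i) = f (g j) := congrArg Subtype.val (hφ hij)
  have h2 : g i = g j := f.injective h1
  ext
  rw [← hg, ← hg, h2]

/-! ### Complete bipartite graphs -/

theorem cycleGraph_free_completeBipartiteGraph {k s : ℕ} (hs : s < k) (B : Type*) :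
    (cycleGraph (2 * k)).Free (completeBipartiteGraph (Fin s) B) := by
  rintro ⟨f⟩
  have := f.le_card_cover (S := Set.range Sum.inl) (ι := Fin s) (by rintro (x | x) (y | y) <;> simp)
    (fun x => x.2.choose) (fun x y hxy => Subtype.ext (by
      rw [← x.2.choose_spec, ← y.2.choose_spec]; exact congrArg _ hxy))
  rw [Fintype.card_fin] at this
  lia

/-- `K_{s,m}` contains `2 (s)_l (m)_l` labelled copies of `C_{2l}`: the cycle starts in either of the
two classes. -/
theorem two_mul_descFactorial_le_genTuran {k l s m n : ℕ} (hl : 2 ≤ l) (hs : s < k)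
    (hn : s + m ≤ n) :
    2 * (s.descFactorial l * m.descFactorial l)
      ≤ genTuran n (cycleGraph (2 * l)) (cycleGraph (2 * k)) * (2 * (2 * l)) := by
  have hcard : Fintype.card (Bool × ((Fin l ↪ Fin s) × (Fin l ↪ Fin m)))
      = 2 * (s.descFactorial l * m.descFactorial l) := by
    simp [Fintype.card_embedding_eq]
  have hl0 : 0 < l := by lia
  let seq : {α : Type} → (Fin l ↪ α) → ℕ → α := fun e i => e ⟨i % l, Nat.mod_lt _ hl0⟩
  have hseq : ∀ {α : Type} (e : Fin l ↪ α), Set.InjOn (seq e) (Set.Iio l) := by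
    intro α e i hi j hj hij
    have := congrArg Fin.val (e.injective hij)
    simpa [Nat.mod_eq_of_lt hi, Nat.mod_eq_of_lt hj] using this
  have hval : ∀ {α : Type} (e : Fin l ↪ α) (i : Fin l), seq e i = e i := by
    intro α e i
    simp only [seq]
    congr 1
    ext
    exact Nat.mod_eq_of_lt i.2
  let G := completeBipartiteGraph (Fin s) (Fin m)
  have hinl : ∀ e : Fin l ↪ Fin s, Set.InjOn (fun i => (Sum.inl (seq e i) : Fin s ⊕ Fin m))
      (Set.Iio l) := fun e => Sum.inl_injective.comp_injOn (hseq e)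
  have hinr : ∀ e : Fin l ↪ Fin m, Set.InjOn (fun i => (Sum.inr (seq e i) : Fin s ⊕ Fin m))
      (Set.Iio l) := fun e => Sum.inr_injective.comp_injOn (hseq e)
  let f : Bool × ((Fin l ↪ Fin s) × (Fin l ↪ Fin m)) → Copy (cycleGraph (2 * l)) G := fun t =>
    if t.1 then
      alternatingCopy hl0 (fun i => Sum.inl (seq t.2.1 i)) (fun i => Sum.inr (seq t.2.2 i))
        (by simp [G]) (by simp [G]) (by simp [G]) (hinl _) (hinr _) (by simp)
    else
      alternatingCopy hl0 (fun i => Sum.inr (seq t.2.2 i)) (fun i => Sum.inl (seq t.2.1 i))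
        (by simp [G]) (by simp [G]) (by simp [G]) (hinr _) (hinl _) (by simp)
  have hf : Function.Injective f := by
    have hT : ∀ (a : Fin l ↪ Fin s) (b : Fin l ↪ Fin m) (i : Fin l),
        f (true, a, b) ⟨2 * i, by lia⟩ = Sum.inl (a i) ∧
          f (true, a, b) ⟨2 * i + 1, by lia⟩ = Sum.inr (b i) := by
      intro a b i
      simp only [f, if_true, alternatingCopy_even, alternatingCopy_odd, hval, and_self]
    have hF : ∀ (a : Fin l ↪ Fin s) (b : Fin l ↪ Fin m) (i : Fin l),
        f (false, a, b) ⟨2 * i, by lia⟩ = Sum.inr (b i) ∧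
          f (false, a, b) ⟨2 * i + 1, by lia⟩ = Sum.inl (a i) := by
      intro a b i
      simp only [f, Bool.false_eq_true, if_false, alternatingCopy_even, alternatingCopy_odd, hval,
        and_self]
    rintro ⟨c, a, b⟩ ⟨c', a', b'⟩ h
    have hx : ∀ x, f (c, a, b) x = f (c', a', b') x := DFunLike.congr_fun h
    cases c <;> cases c'
    · have ha : a = a' := by
        ext i
        have := hx ⟨2 * i + 1, by lia⟩
        rw [(hF a b i).2, (hF a' b' i).2] at this
        rw [Sum.inl_injective this]
      have hb : b = b' := by
        ext i
        have := hx ⟨2 * i, by lia⟩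
        rw [(hF a b i).1, (hF a' b' i).1] at this
        rw [Sum.inr_injective this]
      rw [ha, hb]
    · have := hx ⟨2 * (⟨0, hl0⟩ : Fin l), by lia⟩
      rw [(hF a b ⟨0, hl0⟩).1, (hT a' b' ⟨0, hl0⟩).1] at this
      exact absurd this (by simp)
    · have := hx ⟨2 * (⟨0, hl0⟩ : Fin l), by lia⟩
      rw [(hT a b ⟨0, hl0⟩).1, (hF a' b' ⟨0, hl0⟩).1] at this
      exact absurd this (by simp)
    · have ha : a = a' := by
        ext i
        have := hx ⟨2 * i, by lia⟩
        rw [(hT a b i).1, (hT a' b' i).1] at this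
        rw [Sum.inl_injective this]
      have hb : b = b' := by
        ext i
        have := hx ⟨2 * i + 1, by lia⟩
        rw [(hT a b i).2, (hT a' b' i).2] at this
        rw [Sum.inr_injective this]
      rw [ha, hb]
  rw [← hcard]
  exact card_le_genTuran_cycleGraph (exists_adj_cycleGraph (by lia))
    (cycleGraph_free_completeBipartiteGraph hs (Fin m)) (by lia) (by simpa using hn) f hf

end SimpleGraph

namespace SimpleGraph

/-! ### Blow-ups of every other vertex of a cycle -/

/-- The cycle `C_{2l}` with every other vertex blown up to an independent set of size `m`. The
remaining vertices are the hubs `Sum.inl h`; the hubs `i` and `i + 1` are joined to all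
`Sum.inr (i, x)`. -/
def blowupCycle (l m : ℕ) [NeZero l] : SimpleGraph (Fin l ⊕ Fin l × Fin m) where
  Adj
    | .inl h, .inr p => h = p.1 ∨ h = p.1 + 1
    | .inr p, .inl h => h = p.1 ∨ h = p.1 + 1
    | _, _ => False
  symm := ⟨by rintro (x | x) (y | y) <;> simp⟩
  loopless := ⟨by rintro (x | x) <;> simp⟩

section

variable {l m : ℕ} [NeZero l]

theorem blowupCycle_adj_inl_inr {h : Fin l} {p : Fin l × Fin m} :
    (blowupCycle l m).Adj (.inl h) (.inr p) ↔ h = p.1 ∨ h = p.1 + 1 := Iff.rfl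

theorem blowupCycle_adj_inr_inl {h : Fin l} {p : Fin l × Fin m} :
    (blowupCycle l m).Adj (.inr p) (.inl h) ↔ h = p.1 ∨ h = p.1 + 1 := Iff.rfl

theorem not_blowupCycle_adj_inl_inl {h h' : Fin l} :
    ¬ (blowupCycle l m).Adj (.inl h) (.inl h') := id

theorem not_blowupCycle_adj_inr_inr {p p' : Fin l × Fin m} :
    ¬ (blowupCycle l m).Adj (.inr p) (.inr p') := id

/-- Two distinct hubs at distance two are consecutive. -/
theorem blowupCycle_next_hub {h : Fin l} {y z : Fin l ⊕ Fin l × Fin m}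
    (hy : (blowupCycle l m).Adj (.inl h) y) (hz : (blowupCycle l m).Adj y z) (hne : z ≠ .inl h) :
    ∃ h', z = .inl h' ∧ (h' = h + 1 ∨ h' + 1 = h) := by
  rcases y with y | p
  · exact absurd hy not_blowupCycle_adj_inl_inl
  rcases z with h' | z
  · refine ⟨h', rfl, ?_⟩
    have hne' : h' ≠ h := fun e => hne (e ▸ rfl)
    rw [blowupCycle_adj_inl_inr] at hy
    rw [blowupCycle_adj_inr_inl] at hz
    rcases hy with rfl | rfl <;> rcases hz with rfl | rfl
    · exact absurd rfl hne'
    · exact Or.inl rfl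
    · exact Or.inr rfl
    · exact absurd rfl hne'
  · exact absurd hz not_blowupCycle_adj_inr_inr

/-- The hubs of a cycle of length at least six are closed under passing to the next hub, so that all
`l` of them occur. -/
theorem cycleGraph_free_blowupCycle {k : ℕ} (hk : 3 ≤ k) (hkl : k < l) :
    (cycleGraph (2 * k)).Free (blowupCycle l m) := by
  rintro ⟨f⟩
  obtain ⟨M, hM⟩ : ∃ M, 2 * k = M + 6 := ⟨2 * k - 6, by lia⟩
  have hsurj : ∀ h : Fin l, ∃ x, f x = .inl h := by
    clear hkl
    revert f
    rw [hM]
    intro f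
    have hadj : ∀ x : Fin (M + 6), (blowupCycle l m).Adj (f x) (f (x + 1)) := fun x =>
      f.toHom.map_adj (cycleGraph_adj_succ x)
    have hne : ∀ x y : Fin (M + 6), x ≠ y → f x ≠ f y := fun x y hxy h => hxy (f.injective h)
    have hstep : ∀ h, (∃ x, f x = .inl h) → ∃ x, f x = .inl (h + 1) := by
      rintro h ⟨x, hx⟩
      -- The two hubs at distance two from `h` along the cycle are distinct.
      obtain ⟨h₁, e₁, H₁⟩ := blowupCycle_next_hub (hx ▸ hadj x) (hadj (x + 1))
        (hx ▸ hne _ _ (by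
          intro e
          rw [add_assoc, add_eq_left] at e
          exact ne_of_beq_false rfl e))
      have ha := (hadj (x - 1)).symm
      rw [sub_add_cancel, hx] at ha
      have hb := (hadj (x - 1 - 1)).symm
      rw [sub_add_cancel] at hb
      obtain ⟨h₂, e₂, H₂⟩ := blowupCycle_next_hub ha hb
        (hx ▸ hne _ _ (by
          intro e
          rw [sub_sub, sub_eq_self] at e
          exact ne_of_beq_false rfl e))
      rcases H₁ with rfl | H₁
      · exact ⟨_, e₁⟩
      rcases H₂ with rfl | H₂
      · exact ⟨_, e₂⟩
      have h12 : h₁ = h₂ := add_right_cancel (H₁.trans H₂.symm)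
      refine absurd (e₁.trans (h12 ▸ e₂.symm)) (hne _ _ ?_)
      intro e
      have e' : (1 + 1 + 1 + 1 : Fin (M + 6)) = 0 := by
        have : (x + 1 + 1) - (x - 1 - 1) = (1 + 1 + 1 + 1 : Fin (M + 6)) := by abel
        rw [← this, e, sub_self]
      exact ne_of_beq_false rfl e'
    obtain ⟨h₀, hh₀⟩ : ∃ h₀, ∃ x, f x = .inl h₀ := by
      rcases h0 : f 0 with h | p
      · exact ⟨h, 0, h0⟩
      rcases h1 : f (0 + 1) with h | p'
      · exact ⟨h, _, h1⟩
      have := hadj 0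
      rw [h0, h1] at this
      exact absurd this not_blowupCycle_adj_inr_inr
    have hall : ∀ i : ℕ, ∃ x, f x = .inl (h₀ + Fin.ofNat l i) := by
      intro i
      induction i with
      | zero => simpa using hh₀
      | succ i ih =>
        have : Fin.ofNat l (i + 1) = Fin.ofNat l i + 1 := by
          ext; simp [Fin.val_add]
        rw [this, ← add_assoc]
        exact hstep _ ih
    intro h
    have := hall (h - h₀).val
    simpa using this
  choose g hg using hsurj
  -- Hubs are pairwise non-adjacent, so each of the `k` edges of a perfect matching holds at most one.
  have hle : Fintype.card (Fin l) ≤ Fintype.card (Fin k) := by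
    refine Fintype.card_le_of_injective (fun h => ⟨(g h).val / 2, by lia⟩) fun h h' hh => ?_
    by_contra hne
    have hval : (g h).val ≠ (g h').val := fun e => hne (by
      have := hg h
      rw [Fin.ext e, hg h'] at this
      exact (Sum.inl_injective this).symm)
    have hdiv : (g h).val / 2 = (g h').val / 2 := congrArg Fin.val hh
    have hadj : (cycleGraph (2 * k)).Adj (g h) (g h') := by
      apply pathGraph_le_cycleGraph
      rw [pathGraph_adj]
      lia
    have := f.toHom.map_adj hadj
    rw [Copy.toHom_apply, Copy.toHom_apply, hg, hg] at this
    exact not_blowupCycle_adj_inl_inl this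
  simp at hle
  lia

end

theorem pow_le_genTuran_blowup {k l m n : ℕ} (hk : 3 ≤ k) (hkl : k < l) (hn : l + l * m ≤ n) :
    m ^ l ≤ genTuran n (cycleGraph (2 * l)) (cycleGraph (2 * k)) := by
  have : NeZero l := ⟨by lia⟩
  have hl0 : 0 < l := by lia
  have hsucc : ∀ i, Fin.ofNat l (i + 1) = Fin.ofNat l i + 1 := fun i => by
    ext; simp [Fin.val_add]
  have hinj : Set.InjOn (Fin.ofNat l) (Set.Iio l) := by
    intro i hi j hj hij
    have := congrArg Fin.val hij
    simpa [Nat.mod_eq_of_lt hi, Nat.mod_eq_of_lt hj] using this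
  let f : (Fin l → Fin m) → Copy (cycleGraph (2 * l)) (blowupCycle l m) := fun t =>
    alternatingCopy hl0 (fun i => .inl (Fin.ofNat l i))
      (fun i => .inr (Fin.ofNat l i, t (Fin.ofNat l i)))
      (fun i _ => blowupCycle_adj_inl_inr.2 (Or.inl rfl))
      (fun i _ => blowupCycle_adj_inr_inl.2 (Or.inr (hsucc i)))
      (blowupCycle_adj_inr_inl.2 (Or.inr (by
        rw [← hsucc, Nat.sub_add_cancel hl0]
        ext; simp)))
      (Sum.inl_injective.comp_injOn hinj)
      (fun i hi j hj hij => hinj hi hj (congrArg Prod.fst (Sum.inr_injective hij)))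
      (by simp)
  have hrange : ∀ t, Set.range (f t) = (fun i => Sum.inl (Fin.ofNat l i)) '' Set.Iio l
      ∪ (fun i => Sum.inr (Fin.ofNat l i, t (Fin.ofNat l i))) '' Set.Iio l :=
    fun t => range_alternatingCopy ..
  have hf : Function.Injective fun t => Set.range (f t) := by
    intro t t' h
    ext i
    have hmem : (Sum.inr (i, t i) : Fin l ⊕ Fin l × Fin m) ∈ Set.range (f t) := by
      rw [hrange]
      exact Or.inr ⟨i, i.2, by simp⟩
    have hmem' : (Sum.inr (i, t i) : Fin l ⊕ Fin l × Fin m) ∈ Set.range (f t') := by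
      have h' : Set.range (f t) = Set.range (f t') := h
      rwa [← h']
    rw [hrange] at hmem'
    rcases hmem' with ⟨j, -, hj⟩ | ⟨j, -, hj⟩
    · exact absurd hj (by simp)
    · have := Sum.inr_injective hj
      rw [Prod.mk.injEq] at this
      rw [← this.2, this.1]
  have := card_le_genTuran (exists_adj_cycleGraph (by lia))
    (cycleGraph_free_blowupCycle (m := m) hk hkl) (by simpa using hn) f hf
  simpa using this

/-! ### Point-line incidences -/

section Incidence

variable {F : Type*} [Field F]

/-- The incidence graph of the points `Sum.inl (x, y)` and the non-vertical lines `Sum.inr (a, b)`,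
that is `y = a x + b`, of the affine plane over `F`. -/
def incidenceGraph (F : Type*) [Field F] : SimpleGraph (F × F ⊕ F × F) where
  Adj
    | .inl p, .inr L => p.2 = L.1 * p.1 + L.2
    | .inr L, .inl p => p.2 = L.1 * p.1 + L.2
    | _, _ => False
  symm := ⟨by rintro (x | x) (y | y) <;> simp⟩
  loopless := ⟨by rintro (x | x) <;> simp⟩

theorem incidenceGraph_adj_inl_inr {p L : F × F} :
    (incidenceGraph F).Adj (.inl p) (.inr L) ↔ p.2 = L.1 * p.1 + L.2 := Iff.rfl

theorem eq_or_eq_of_incident {p p' L L' : F × F} (h1 : p.2 = L.1 * p.1 + L.2)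
    (h2 : p'.2 = L.1 * p'.1 + L.2) (h3 : p.2 = L'.1 * p.1 + L'.2)
    (h4 : p'.2 = L'.1 * p'.1 + L'.2) : p = p' ∨ L = L' := by
  have h : (L.1 - L'.1) * (p.1 - p'.1) = 0 := by linear_combination h3 - h1 + h2 - h4
  rcases mul_eq_zero.1 h with h | h
  · right
    have h5 : L.1 = L'.1 := sub_eq_zero.1 h
    refine Prod.ext h5 ?_
    rw [h5] at h1
    exact add_left_cancel (h1.symm.trans h3)
  · left
    have h5 : p.1 = p'.1 := sub_eq_zero.1 h
    refine Prod.ext h5 ?_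
    rw [h1, h2, h5]

theorem cycleGraph_four_free_incidenceGraph : (cycleGraph (2 * 2)).Free (incidenceGraph F) := by
  have key : ∀ x₀ x₁ x₂ x₃ : F × F ⊕ F × F, (incidenceGraph F).Adj x₀ x₁ →
      (incidenceGraph F).Adj x₁ x₂ → (incidenceGraph F).Adj x₂ x₃ → (incidenceGraph F).Adj x₃ x₀ →
      x₀ ≠ x₂ → x₁ ≠ x₃ → False := by
    rintro (p | p) (q | q) (r | r) (s | s) h01 h12 h23 h30 h02 h13 <;>
      simp only [incidenceGraph] at h01 h12 h23 h30
    · rcases eq_or_eq_of_incident h01 h12 h30 h23 with h | h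
      · exact h02 (h ▸ rfl)
      · exact h13 (h ▸ rfl)
    · rcases eq_or_eq_of_incident h01 h30 h12 h23 with h | h
      · exact h13 (h ▸ rfl)
      · exact h02 (h ▸ rfl)
  rintro ⟨f⟩
  have hne : ∀ i j : Fin (2 * 2), i ≠ j → f.toHom i ≠ f.toHom j := fun i j h e =>
    h (f.injective e)
  exact key (f.toHom 0) (f.toHom 1) (f.toHom 2) (f.toHom 3)
    (f.toHom.map_adj (by decide)) (f.toHom.map_adj (by decide)) (f.toHom.map_adj (by decide))
    (f.toHom.map_adj (by decide)) (hne _ _ (by decide)) (hne _ _ (by decide))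

/-- Slope and intercept of the line through two points with distinct first coordinates. -/
def lineThrough (p q : F × F) : F × F :=
  ((p.2 - q.2) / (p.1 - q.1), p.2 - (p.2 - q.2) / (p.1 - q.1) * p.1)

theorem left_mem_lineThrough (p q : F × F) :
    p.2 = (lineThrough p q).1 * p.1 + (lineThrough p q).2 := by
  simp [lineThrough]

theorem right_mem_lineThrough {p q : F × F} (h : p.1 ≠ q.1) :
    q.2 = (lineThrough p q).1 * q.1 + (lineThrough p q).2 := by
  have : p.1 - q.1 ≠ 0 := sub_ne_zero.2 h
  simp only [lineThrough]
  field_simp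
  ring

/-- Sequences of points with distinct first coordinates, none of which is on a line through two later
ones. -/
def InGeneralPosition {l : ℕ} (p : Fin l → F × F) : Prop :=
  (∀ i j, i < j → (p i).1 ≠ (p j).1) ∧
    ∀ i j j', i < j → i < j' →
      (p i).2 ≠ (lineThrough (p j) (p j')).1 * (p i).1 + (lineThrough (p j) (p j')).2

theorem InGeneralPosition.fst_ne {l : ℕ} {p : Fin l → F × F} (hp : InGeneralPosition p)
    {i j : Fin l} (hij : i ≠ j) : (p i).1 ≠ (p j).1 := by
  rcases lt_or_gt_of_ne hij with h | h
  · exact hp.1 i j h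
  · exact (hp.1 j i h).symm

theorem InGeneralPosition.not_collinear {l : ℕ} {p : Fin l → F × F} (hp : InGeneralPosition p)
    {i j j' : Fin l} (hij : i ≠ j) (hij' : i ≠ j') (hjj' : j ≠ j') (L : F × F)
    (h : ∀ x, x = i ∨ x = j ∨ x = j' → (p x).2 = L.1 * (p x).1 + L.2) : False := by
  have key : ∀ a b c : Fin l, a < b → a < c → b ≠ c →
      (∀ x, x = a ∨ x = b ∨ x = c → (p x).2 = L.1 * (p x).1 + L.2) → False := by
    intro a b c hab hac hbc H
    have hL : L = lineThrough (p b) (p c) := by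
      refine (eq_or_eq_of_incident (H b (by simp)) (H c (by simp)) (left_mem_lineThrough _ _)
        (right_mem_lineThrough (hp.fst_ne hbc))).resolve_left fun e => hp.fst_ne hbc (e ▸ rfl)
    exact hp.2 a b c hab hac (hL ▸ H a (by simp))
  rcases lt_or_gt_of_ne hij with h1 | h1
  · rcases lt_or_gt_of_ne hij' with h2 | h2
    · exact key i j j' h1 h2 hjj' h
    · exact key j' i j h2 (h2.trans h1) hij fun x hx => h x (by tauto)
  · rcases lt_or_gt_of_ne hjj' with h2 | h2
    · exact key j i j' h1 h2 hij' fun x hx => h x (by tauto)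
    · exact key j' i j (h2.trans h1) h2 hij fun x hx => h x (by tauto)

variable [Fintype F]

/-- A further point in general position only has to avoid few columns and lines. -/
theorem exists_finset_inGeneralPosition (N m : ℕ) (l : ℕ) (hl : l ≤ m)
    (hN : N + (m + m * m) * Fintype.card F ≤ Fintype.card F ^ 2) :
    ∃ S : Finset (Fin l → F × F), N ^ l ≤ S.card ∧ ∀ p ∈ S, InGeneralPosition p := by
  classical
  induction l with
  | zero => exact ⟨{Fin.elim0}, by simp, fun p _ => ⟨fun i => i.elim0, fun i => i.elim0⟩⟩
  | succ l ih =>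
    obtain ⟨S, hS, hgood⟩ := ih (by lia)
    let column : F × F → Finset (F × F) := fun p => Finset.univ.image fun y => (p.1, y)
    let line : F × F → Finset (F × F) := fun L => Finset.univ.image fun x => (x, L.1 * x + L.2)
    let B : (Fin l → F × F) → Finset (F × F) := fun p =>
      (Finset.univ.biUnion fun i => column (p i)) ∪
        Finset.univ.biUnion fun ij : Fin l × Fin l => line (lineThrough (p ij.1) (p ij.2))
    have hB : ∀ p, N ≤ (B p)ᶜ.card := by
      intro p
      have h1 : (Finset.univ.biUnion fun i => column (p i)).card ≤ l * Fintype.card F := by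
        have := Finset.card_biUnion_le_card_mul Finset.univ (fun i => column (p i))
          (Fintype.card F) fun i _ => Finset.card_image_le
        simpa using this
      have h2 : (Finset.univ.biUnion fun ij : Fin l × Fin l =>
          line (lineThrough (p ij.1) (p ij.2))).card ≤ l * l * Fintype.card F := by
        have := Finset.card_biUnion_le_card_mul Finset.univ
          (fun ij : Fin l × Fin l => line (lineThrough (p ij.1) (p ij.2)))
          (Fintype.card F) fun i _ => Finset.card_image_le
        simpa using this
      have h3 : (B p).card ≤ (m + m * m) * Fintype.card F :=
        (Finset.card_union_le _ _).trans ((add_le_add h1 h2).trans (by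
          rw [← add_mul]
          have : l ≤ m := by lia
          gcongr))
      rw [Finset.card_compl, Fintype.card_prod, ← sq]
      lia
    refine ⟨(S.sigma fun p => (B p)ᶜ).image fun s => Fin.cons s.2 s.1, ?_, ?_⟩
    · rw [Finset.card_image_of_injective, Finset.card_sigma, pow_succ]
      · calc N ^ l * N ≤ S.card * N := by gcongr
          _ = ∑ _p ∈ S, N := by simp
          _ ≤ _ := Finset.sum_le_sum fun p _ => hB p
      · rintro ⟨p, c⟩ ⟨p', c'⟩ h
        obtain ⟨rfl, rfl⟩ := Fin.cons_inj.1 h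
        rfl
    · intro p' hp'
      obtain ⟨⟨p, c⟩, hpc, rfl⟩ := Finset.mem_image.1 hp'
      rw [Finset.mem_sigma, Finset.mem_compl, Finset.mem_union, not_or, Finset.mem_biUnion,
        Finset.mem_biUnion] at hpc
      obtain ⟨hp, hcol, hline⟩ := hpc
      have hg := hgood p hp
      constructor
      · intro i j hij
        induction j using Fin.cases with
        | zero => exact absurd hij (Fin.not_lt_zero _)
        | succ j =>
          induction i using Fin.cases with
          | zero =>
            simp only [Fin.cons_zero, Fin.cons_succ]
            intro e
            exact hcol ⟨j, Finset.mem_univ _,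
              Finset.mem_image.2 ⟨c.2, Finset.mem_univ _, Prod.ext e.symm rfl⟩⟩
          | succ i => exact hg.1 i j (Fin.succ_lt_succ_iff.1 hij)
      · intro i j j' hij hij'
        induction j using Fin.cases with
        | zero => exact absurd hij (Fin.not_lt_zero _)
        | succ j =>
          induction j' using Fin.cases with
          | zero => exact absurd hij' (Fin.not_lt_zero _)
          | succ j' =>
            induction i using Fin.cases with
            | zero =>
              simp only [Fin.cons_zero, Fin.cons_succ]
              intro e
              exact hline ⟨(j, j'), Finset.mem_univ _,
                Finset.mem_image.2 ⟨c.1, Finset.mem_univ _, Prod.ext rfl e.symm⟩⟩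
            | succ i => exact hg.2 i j j' (Fin.succ_lt_succ_iff.1 hij) (Fin.succ_lt_succ_iff.1 hij')

/-- Consecutive points of a sequence in general position span the lines of a cycle. -/
theorem pow_le_genTuran_incidence {l n N : ℕ} (hl : 3 ≤ l) (hn : 2 * Fintype.card F ^ 2 ≤ n)
    (hN : N + (l + l * l) * Fintype.card F ≤ Fintype.card F ^ 2) :
    N ^ l ≤ genTuran n (cycleGraph (2 * l)) (cycleGraph (2 * 2)) * (2 * (2 * l)) := by
  obtain ⟨S, hS, hgood⟩ := exists_finset_inGeneralPosition (F := F) N l l le_rfl hN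
  obtain ⟨M, rfl⟩ := Nat.exists_eq_add_of_le' hl
  have hsucc : ∀ i, Fin.ofNat (M + 3) (i + 1) = Fin.ofNat (M + 3) i + 1 := fun i => by
    ext; simp [Fin.val_add]
  have hinj : Set.InjOn (Fin.ofNat (M + 3)) (Set.Iio (M + 3)) := by
    intro i hi j hj hij
    have := congrArg Fin.val hij
    simpa [Nat.mod_eq_of_lt hi, Nat.mod_eq_of_lt hj] using this
  have h1 : ∀ i : Fin (M + 3), i ≠ i + 1 := fun i h => by
    rw [left_eq_add] at h
    exact ne_of_beq_false rfl h
  have h2 : ∀ i : Fin (M + 3), i ≠ i + 1 + 1 := fun i h => by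
    rw [add_assoc, left_eq_add] at h
    exact ne_of_beq_false rfl h
  have hline : ∀ p ∈ S, ∀ i : Fin (M + 3), (incidenceGraph F).Adj (.inl (p (i + 1)))
      (.inr (lineThrough (p i) (p (i + 1)))) := fun p hp i =>
    right_mem_lineThrough ((hgood p hp).fst_ne (h1 i))
  have hline_inj : ∀ p ∈ S, ∀ i j : Fin (M + 3),
      lineThrough (p i) (p (i + 1)) = lineThrough (p j) (p (j + 1)) → i = j := by
    intro p hp i j hij
    by_contra hne
    have hi1 := left_mem_lineThrough (p i) (p (i + 1))
    have hi2 := right_mem_lineThrough ((hgood p hp).fst_ne (h1 i))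
    have hj1 := left_mem_lineThrough (p j) (p (j + 1))
    have hj2 := right_mem_lineThrough ((hgood p hp).fst_ne (h1 j))
    rw [← hij] at hj1 hj2
    -- Two coinciding lines would hold three of the points.
    by_cases hc : i + 1 = j
    · subst hc
      refine (hgood p hp).not_collinear (h1 i) (h2 i) (h1 _)
        (lineThrough (p i) (p (i + 1))) ?_
      rintro x (rfl | rfl | rfl) <;> assumption
    · refine (hgood p hp).not_collinear (h1 i) hne hc
        (lineThrough (p i) (p (i + 1))) ?_
      rintro x (rfl | rfl | rfl) <;> assumption
  let f : S → Copy (cycleGraph (2 * (M + 3))) (incidenceGraph F) := fun p =>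
    alternatingCopy (by lia) (fun i => .inl (p.1 (Fin.ofNat (M + 3) i)))
      (fun i => .inr (lineThrough (p.1 (Fin.ofNat (M + 3) i)) (p.1 (Fin.ofNat (M + 3) i + 1))))
      (fun i _ => incidenceGraph_adj_inl_inr.2 (left_mem_lineThrough _ _))
      (fun i _ => (by rw [hsucc]; exact (hline p.1 p.2 _).symm))
      (by
        have h0 : Fin.ofNat (M + 3) 0 = Fin.ofNat (M + 3) (M + 3 - 1) + 1 := by
          rw [← hsucc]; ext; simp
        rw [h0]
        exact (hline p.1 p.2 _).symm)
      (fun i hi j hj hij => by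
        by_contra hne
        exact (hgood p.1 p.2).fst_ne (fun e => hne (hinj hi hj e))
          (congrArg Prod.fst (Sum.inl_injective hij)))
      (fun i hi j hj hij => hinj hi hj (hline_inj p.1 p.2 _ _ (Sum.inr_injective hij)))
      (by simp)
  have heven : ∀ p, ∀ i : Fin (M + 3),
      f p ⟨2 * i, by lia⟩ = Sum.inl (p.1 (Fin.ofNat (M + 3) i)) :=
    fun p i => alternatingCopy_even ..
  have hf : Function.Injective f := by
    intro p q h
    ext1
    funext i
    have := DFunLike.congr_fun h ⟨2 * i, by lia⟩
    rw [heven, heven] at this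
    simpa using Sum.inl_injective this
  have hcard := card_le_genTuran_cycleGraph (exists_adj_cycleGraph (by lia))
    (cycleGraph_four_free_incidenceGraph (F := F)) (n := n) (by lia)
    (by rw [Fintype.card_sum, Fintype.card_prod]; linarith) f hf
  rw [Fintype.card_coe] at hcard
  exact hS.trans hcard

end Incidence

end SimpleGraph

/-! ### Bounds for `exEvenCycle` -/

namespace SimpleGraph

theorem genTuran_le_of_forall {W X : Type*} {H : SimpleGraph W} {F : SimpleGraph X} {n : ℕ} {B : ℝ}
    (hB : 0 ≤ B) (h : ∀ G : SimpleGraph (Fin n), F.Free G → (G.copyCount H : ℝ) ≤ B) :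
    (genTuran n H F : ℝ) ≤ B := by
  classical
  rw [← Nat.le_floor_iff hB]
  refine Finset.sup_le fun G hG => ?_
  rw [Nat.le_floor_iff hB]
  exact h G (Finset.mem_filter.1 hG).2

/-- The upper bound on the number of `2l`-cycles, in squared form to avoid the root of `5/2`. -/
theorem eventually_exEvenCycle_le {k : ℕ} (hk : 2 ≤ k) :
    ∀ᶠ n : ℕ in atTop, ∀ (l : ℕ) (B : ℝ), 2 ≤ l → 0 ≤ B →
      (5 / 2) ^ l * (((k : ℝ) - 1) ^ l * (n : ℝ) ^ l) ^ 2 ≤ (B * (4 * l)) ^ 2 →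
      exEvenCycle l k n ≤ B := by
  obtain ⟨n₀, hn₀⟩ := exists_sum_codeg_sq_le hk
  filter_upwards [eventually_ge_atTop n₀] with n hn l B hl hB hle
  refine genTuran_le_of_forall hB fun G hG => ?_
  classical
  have h1 := hn₀ G (by simpa using hn) hG
  have h2 := G.labelledCopyCount_cycleGraph_sq_le hl
  have h3 : (∑ p : Fin n × Fin n, (G.codeg p : ℝ) ^ 2) ^ l
      ≤ (5 / 2 * ((k : ℝ) - 1) ^ 2 * (n : ℝ) ^ 2) ^ l := by
    gcongr
    simpa using h1
  have h4 : (5 / 2 * ((k : ℝ) - 1) ^ 2 * (n : ℝ) ^ 2) ^ l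
      = (5 / 2) ^ l * (((k : ℝ) - 1) ^ l * (n : ℝ) ^ l) ^ 2 := by
    rw [mul_pow, mul_pow, pow_right_comm _ 2 l, pow_right_comm (n : ℝ) 2 l]; ring
  have h5 : (G.labelledCopyCount (cycleGraph (2 * l)) : ℝ) ≤ B * (4 * l) :=
    le_of_sq_le_sq (h2.trans (h3.trans (h4.le.trans hle))) (by positivity)
  rw [labelledCopyCount_cycleGraph G (by lia)] at h5
  push_cast at h5
  have hl0 : (0 : ℝ) < 4 * l := by positivity
  refine le_of_mul_le_mul_right ?_ hl0
  linarith

theorem exEvenCycle_nonneg (l k n : ℕ) : 0 ≤ exEvenCycle l k n := Nat.cast_nonneg _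

theorem exEvenCycle_zero {l k : ℕ} (hl : 0 < l) : exEvenCycle l k 0 ≤ 0 := by
  refine genTuran_le_of_forall le_rfl fun G _ => ?_
  rw [Nat.cast_nonpos, copyCount_eq_zero]
  rintro ⟨f⟩
  exact (f ⟨0, by lia⟩).elim0

theorem le_exEvenCycle_of_lt {l k : ℕ} (hl : 2 ≤ l) (hlk : l < k) (n : ℕ) :
    ((k - 1).descFactorial l : ℝ) / (2 * l) * ((n - (k + l) : ℕ) : ℝ) ^ l ≤ exEvenCycle l k n := by
  rcases Nat.lt_or_ge n (k + l) with hn | hn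
  · rw [Nat.sub_eq_zero_of_le hn.le, Nat.cast_zero, zero_pow (by lia), mul_zero]
    exact exEvenCycle_nonneg _ _ _
  have h := two_mul_descFactorial_le_genTuran (k := k) (s := k - 1) (m := n - (k - 1)) (n := n) hl
    (by lia) (by lia)
  have h1 : (n - (k + l)) ^ l ≤ (n - (k - 1)).descFactorial l :=
    (Nat.pow_le_pow_left (by lia) l).trans (Nat.pow_sub_le_descFactorial _ l)
  have h2 : 2 * ((k - 1).descFactorial l * (n - (k + l)) ^ l)
      ≤ genTuran n (cycleGraph (2 * l)) (cycleGraph (2 * k)) * (2 * (2 * l)) :=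
    le_trans (by gcongr) h
  have h3 : (2 : ℝ) * (((k - 1).descFactorial l : ℝ) * ((n - (k + l) : ℕ) : ℝ) ^ l)
      ≤ exEvenCycle l k n * (2 * (2 * l)) := by
    rw [exEvenCycle]; exact_mod_cast h2
  have hl0 : (0 : ℝ) < 2 * l := by positivity
  rw [div_mul_eq_mul_div, div_le_iff₀ hl0]
  linarith

theorem le_exEvenCycle_of_gt {l k : ℕ} (hk : 3 ≤ k) (hkl : k < l) (n : ℕ) :
    1 / (l : ℝ) ^ l * ((n - 2 * l : ℕ) : ℝ) ^ l ≤ exEvenCycle l k n := by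
  rcases Nat.lt_or_ge n (2 * l) with hn | hn
  · rw [Nat.sub_eq_zero_of_le hn.le, Nat.cast_zero, zero_pow (by lia), mul_zero]
    exact exEvenCycle_nonneg _ _ _
  have hl0 : 0 < l := by lia
  have hdiv := Nat.div_add_mod (n - l) l
  have hmod := Nat.mod_lt (n - l) hl0
  have h := pow_le_genTuran_blowup (n := n) (m := (n - l) / l) hk hkl (by lia)
  have h1 : (n - 2 * l) ^ l ≤ l ^ l * ((n - l) / l) ^ l := by
    rw [← mul_pow]
    exact Nat.pow_le_pow_left (by lia) l
  have h2 : (n - 2 * l) ^ l ≤ l ^ l * genTuran n (cycleGraph (2 * l)) (cycleGraph (2 * k)) :=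
    h1.trans (Nat.mul_le_mul_left _ h)
  have h3 : ((n - 2 * l : ℕ) : ℝ) ^ l ≤ (l : ℝ) ^ l * exEvenCycle l k n := by
    rw [exEvenCycle]; exact_mod_cast h2
  have hl1 : (0 : ℝ) < (l : ℝ) ^ l := by positivity
  rw [one_div, inv_mul_le_iff₀ hl1]
  exact h3

/-- `C_4`-free graphs with many `2l`-cycles: the incidence graph over the field with `p` elements,
for a prime `p` with `p ^ 2` of the order of `n` supplied by Bertrand's postulate. -/
theorem eventually_le_exEvenCycle_two {l : ℕ} (hl : 3 ≤ l) :
    ∀ᶠ n : ℕ in atTop, (n : ℝ) ^ l ≤ 16 ^ l * (4 * l) * exEvenCycle l 2 n := by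
  set m : ℕ := l + l * l with hm
  filter_upwards [eventually_ge_atTop (8 * (2 * m + 1) ^ 2)] with n hn
  set s : ℕ := Nat.sqrt (n / 8) with hs
  have hs1 : 2 * m + 1 ≤ s := by
    rw [hs, Nat.le_sqrt, ← sq]
    lia
  obtain ⟨p, hp, hsp, hps⟩ := Nat.exists_prime_lt_and_le_two_mul s (by lia)
  have : Fact p.Prime := ⟨hp⟩
  have hss : s * s ≤ n / 8 := Nat.sqrt_le _
  have hss' : n / 8 < (s + 1) * (s + 1) := Nat.lt_succ_sqrt _
  have h1 : 2 * p ^ 2 ≤ n := by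
    have : p ^ 2 ≤ (2 * s) ^ 2 := Nat.pow_le_pow_left hps 2
    have : (2 * s) ^ 2 = 4 * (s * s) := by ring
    lia
  have h2 : n ≤ 8 * p ^ 2 := by
    have : (s + 1) * (s + 1) ≤ p ^ 2 := by rw [sq]; gcongr <;> lia
    lia
  have h3 : 2 * (m * p) ≤ p ^ 2 := by
    rw [sq, ← mul_assoc]; gcongr; lia
  have hcard : Fintype.card (ZMod p) = p := ZMod.card p
  have h4 := pow_le_genTuran_incidence (F := ZMod p) (N := p ^ 2 - m * p) (n := n) hl
    (by rw [hcard]; exact h1) (by rw [hcard, ← hm]; lia)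
  have h5 : n ^ l ≤ 16 ^ l * (4 * l) * genTuran n (cycleGraph (2 * l)) (cycleGraph (2 * 2)) := by
    calc n ^ l ≤ (16 * (p ^ 2 - m * p)) ^ l := Nat.pow_le_pow_left (by lia) l
      _ = 16 ^ l * (p ^ 2 - m * p) ^ l := mul_pow _ _ _
      _ ≤ 16 ^ l * (genTuran n (cycleGraph (2 * l)) (cycleGraph (2 * 2)) * (2 * (2 * l))) :=
        Nat.mul_le_mul_left _ h4
      _ = _ := by ring
  rw [exEvenCycle]
  exact_mod_cast h5

end SimpleGraph

/-! ### Asymptotic notation -/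

theorem asympLE_of_eventually_le {f g : ℕ → ℝ} (h : ∀ᶠ n in atTop, f n ≤ g n)
    (h0 : ∀ n, f n ≤ g n ∨ 0 < g n) : AsympLE f g := by
  classical
  refine ⟨fun n => if f n ≤ g n then 0 else f n / g n - 1, ?_, fun n => ?_⟩
  · refine tendsto_const_nhds.congr' ?_
    filter_upwards [h] with n hn
    rw [if_pos hn]
  · dsimp only
    split_ifs with hn
    · simpa using hn
    · have := (h0 n).resolve_left hn
      rw [add_sub_cancel, div_mul_cancel₀ _ this.ne']

theorem tendsto_sub_pow_div (a l : ℕ) :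
    Tendsto (fun n : ℕ => ((n - a : ℕ) : ℝ) ^ l / (n : ℝ) ^ l) atTop (𝓝 1) := by
  have h1 : Tendsto (fun n : ℕ => (1 - (a : ℝ) / n) ^ l) atTop (𝓝 1) := by
    have := (tendsto_const_div_atTop_nhds_zero_nat (a : ℝ)).const_sub 1 |>.pow l
    simpa using this
  refine h1.congr' ?_
  filter_upwards [eventually_ge_atTop (a + 1)] with n hn
  have : (n : ℝ) ≠ 0 := Nat.cast_ne_zero.2 (by lia)
  rw [← div_pow, Nat.cast_sub (by lia), sub_div, div_self this]

theorem asympGE_of_sub_pow_le {f : ℕ → ℝ} {c : ℝ} {a l : ℕ} (hl : l ≠ 0)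
    (h : ∀ n : ℕ, c * ((n - a : ℕ) : ℝ) ^ l ≤ f n) :
    AsympGE f fun n => c * (n : ℝ) ^ l := by
  refine ⟨fun n => ((n - a : ℕ) : ℝ) ^ l / (n : ℝ) ^ l - 1, ?_, fun n => ?_⟩
  · simpa using (tendsto_sub_pow_div a l).sub_const 1
  · refine le_trans (le_of_eq ?_) (h n)
    dsimp only
    rcases Nat.eq_zero_or_pos n with rfl | hn
    · simp [hl]
    · have : (n : ℝ) ^ l ≠ 0 := by positivity
      field_simp
      ring

theorem isBigO_of_sub_pow_le {f : ℕ → ℝ} {c : ℝ} {a l : ℕ} (hc : 0 < c)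
    (h : ∀ n : ℕ, c * ((n - a : ℕ) : ℝ) ^ l ≤ f n) :
    (fun n : ℕ => (n : ℝ) ^ l) =O[atTop] f := by
  refine IsBigO.of_bound (2 ^ l / c) ?_
  filter_upwards [eventually_ge_atTop (2 * a)] with n hn
  have h1 : (n : ℝ) ≤ 2 * ((n - a : ℕ) : ℝ) := by
    exact_mod_cast (by lia : n ≤ 2 * (n - a))
  have h2 : (n : ℝ) ^ l ≤ 2 ^ l * ((n - a : ℕ) : ℝ) ^ l := by
    rw [← mul_pow]; gcongr
  rw [Real.norm_of_nonneg (by positivity), div_mul_eq_mul_div, le_div_iff₀ hc]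
  calc (n : ℝ) ^ l * c ≤ 2 ^ l * ((n - a : ℕ) : ℝ) ^ l * c := by gcongr
    _ = 2 ^ l * (c * ((n - a : ℕ) : ℝ) ^ l) := by ring
    _ ≤ 2 ^ l * ‖f n‖ := by
      gcongr
      exact (h n).trans (le_abs_self _)

theorem isBigO_exEvenCycle {l k : ℕ} (hl : 2 ≤ l) (hk : 2 ≤ k) :
    exEvenCycle l k =O[atTop] (fun n : ℕ => (n : ℝ) ^ l) := by
  refine IsBigO.of_bound (2 ^ l * ((k : ℝ) - 1) ^ l) ?_
  have hk1 : (0 : ℝ) ≤ (k : ℝ) - 1 := by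
    have : (2 : ℝ) ≤ k := by exact_mod_cast hk
    linarith
  filter_upwards [SimpleGraph.eventually_exEvenCycle_le hk] with n hn
  rw [Real.norm_of_nonneg (SimpleGraph.exEvenCycle_nonneg _ _ _),
    Real.norm_of_nonneg (by positivity)]
  refine hn l _ hl (by positivity) ?_
  have h4 : (1 : ℝ) ≤ (4 * (l : ℝ)) ^ 2 := by
    have : (2 : ℝ) ≤ l := by exact_mod_cast hl
    nlinarith
  have h5 : (5 / 2 : ℝ) ^ l ≤ 4 ^ l := by gcongr; norm_num
  calc (5 / 2 : ℝ) ^ l * (((k : ℝ) - 1) ^ l * (n : ℝ) ^ l) ^ 2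
      ≤ 4 ^ l * (((k : ℝ) - 1) ^ l * (n : ℝ) ^ l) ^ 2 * (4 * (l : ℝ)) ^ 2 := by
        exact (mul_le_mul_of_nonneg_right h5 (by positivity)).trans
          (le_mul_of_one_le_right (by positivity) h4)
    _ = (2 ^ l * ((k : ℝ) - 1) ^ l * (n : ℝ) ^ l * (4 * l)) ^ 2 := by
        rw [show (4 : ℝ) = 2 ^ 2 by norm_num, ← pow_mul, mul_comm 2 l, pow_mul]; ring

theorem five_halves_pow_le {l : ℕ} (hl : 3 ≤ l) : (5 / 2 : ℝ) ^ l ≤ (2 ^ (l - 1)) ^ 2 := by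
  obtain ⟨m, rfl⟩ := Nat.exists_eq_add_of_le' hl
  have h : (5 / 2 : ℝ) ^ m ≤ 4 ^ m := by gcongr; norm_num
  have h' : (0 : ℝ) < 4 ^ m := by positivity
  rw [Nat.add_sub_assoc (by norm_num), ← pow_mul, mul_comm, pow_mul, pow_add, pow_add]
  norm_num
  linarith

theorem theorem2p1 :
    (∀ l k : ℕ, 3 ≤ l → 2 ≤ k →
      AsympLE (exEvenCycle l k)
        (fun n => 2 ^ (l - 2) * ((k : ℝ) - 1) ^ l / (2 * (l : ℝ)) * (n : ℝ) ^ l)) ∧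
    (∀ l k : ℕ, 2 ≤ l → l < k →
      AsympGE (exEvenCycle l k)
        (fun n => ((k - 1).descFactorial l : ℝ) / (2 * (l : ℝ)) * (n : ℝ) ^ l)) ∧
    (∀ l k : ℕ, 3 ≤ k → k < l →
      AsympGE (exEvenCycle l k) (fun n => 1 / (l : ℝ) ^ l * (n : ℝ) ^ l)) ∧
    (∀ l k : ℕ, 2 ≤ l → 2 ≤ k → l ≠ k →
      exEvenCycle l k =Θ[atTop] (fun n : ℕ => (n : ℝ) ^ l)) := by
  refine ⟨fun l k hl hk => ?_, fun l k hl hlk => ?_, fun l k hk hkl => ?_, fun l k hl hk hne => ?_⟩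
  · have hk1 : (0 : ℝ) < (k : ℝ) - 1 := by
      have : (2 : ℝ) ≤ k := by exact_mod_cast hk
      linarith
    have hl0 : (0 : ℝ) < l := by positivity
    refine asympLE_of_eventually_le ?_ fun n => ?_
    · filter_upwards [SimpleGraph.eventually_exEvenCycle_le hk] with n hn
      refine hn l _ (by lia) (by positivity) ?_
      have h2 : (2 : ℝ) ^ (l - 1) = 2 * 2 ^ (l - 2) := by
        rw [← pow_succ']; congr 1; lia
      have hB : 2 ^ (l - 2) * ((k : ℝ) - 1) ^ l / (2 * (l : ℝ)) * (n : ℝ) ^ l * (4 * l)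
          = 2 ^ (l - 1) * (((k : ℝ) - 1) ^ l * (n : ℝ) ^ l) := by
        rw [h2]; field_simp; ring
      rw [hB, mul_pow (2 ^ (l - 1) : ℝ)]
      exact mul_le_mul_of_nonneg_right (five_halves_pow_le hl) (by positivity)
    · rcases Nat.eq_zero_or_pos n with rfl | hn
      · left
        rw [Nat.cast_zero, zero_pow (by lia), mul_zero]
        exact SimpleGraph.exEvenCycle_zero (by lia)
      · right
        positivity
  · exact asympGE_of_sub_pow_le (by lia) (SimpleGraph.le_exEvenCycle_of_lt hl hlk)
  · exact asympGE_of_sub_pow_le (by lia) (SimpleGraph.le_exEvenCycle_of_gt hk hkl)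
  · refine ⟨isBigO_exEvenCycle hl hk, ?_⟩
    rcases lt_or_gt_of_ne hne with hlk | hkl
    · refine isBigO_of_sub_pow_le ?_ (SimpleGraph.le_exEvenCycle_of_lt hl hlk)
      have : 0 < (k - 1).descFactorial l := Nat.descFactorial_pos.2 (by lia)
      positivity
    · rcases Nat.lt_or_ge 2 k with hk3 | hk2
      · exact isBigO_of_sub_pow_le (by positivity) (SimpleGraph.le_exEvenCycle_of_gt hk3 hkl)
      · obtain rfl : k = 2 := le_antisymm hk2 hk
        refine IsBigO.of_bound (16 ^ l * (4 * l)) ?_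
        filter_upwards [SimpleGraph.eventually_le_exEvenCycle_two hkl] with n hn
        rwa [Real.norm_of_nonneg (by positivity),
          Real.norm_of_nonneg (SimpleGraph.exEvenCycle_nonneg _ _ _)]
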